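/- Theorem 2.2. Let $\mathbb K\in\{\mathbb R,\mathbb C\}$, let $H$ be a Hilbert space over $\mathbb K$ with $\dim H\neq 2$ (of any other dimension, finite or infinite), let $S$ be a dense linear submanifold of $H$, and let $\mathcal S(S)$ denote the set of unit vectors of $S$. Let $f:\mathcal S(S)\to[-\infty,\infty]$ be a function such that (i) for every orthonormal system $\{x_i\}$ in $S$, either $\{f(x_i)\}$ is summable (with a real sum) or $\sum_i f(x_i)=\infty$; (ii) for every finite-dimensional subspace $K$ of $S$, the restriction $f|\mathcal S(K)$ is a frame function on $K$, i.e. for each subspace $M$ of $K$ there is a constant $W_M\in[-\infty,\infty]$ with $\sum_i f(x_i)=W_M$ for every orthonormal base $\{x_i\}$ of $M$ (such an $f$ is called a frame type function on $H$; sums are independent of the order of the terms). Suppose that $f$ is finite, i.e. $-\infty<f(x)<\infty$ for all $x\in\mathcal S(S)$, and semibounded, i.e. $\inf\{f(x):x\in\mathcal S(S)\}>-\infty$ (with $\inf\emptyset=\infty$). Then there is a unique map $t:S\times S\to\mathbb K$ that (a) is linear in the first and antilinear in the second argument (a bilinear form with domain $D(t)=S$); (b) is symmetric, $t(x,y)=\overline{t(y,x)}$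 for all $x,y\in S$; (c) is semibounded, $\inf\{t(x,x):x\in\mathcal S(S)\}>-\infty$; (d) satisfies $f(x)=t(x,x)$ for all $x\in\mathcal S(S)$. -/

import Mathlib

open Metric

/-- The (extended real) sum of the family `a` exists and equals `w`: the family does not contain
both `∞` and `-∞`, and its finite partial sums converge unconditionally to `w` in `[-∞, ∞]`. -/
def HasExtSum {ι : Type*} (a : ι → EReal) (w : EReal) : Prop :=
  ¬ ((∃ i, a i = ⊤) ∧ (∃ j, a j = ⊥)) ∧ HasSum a w

/-- An orthonormal system, given as a set of unit vectors. -/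
def IsONS (𝕜 : Type*) {E : Type*} [RCLike 𝕜] [NormedAddCommGroup E] [InnerProductSpace 𝕜 E]
    (A : Set (sphere (0 : E) 1)) : Prop :=
  Orthonormal 𝕜 (fun x : A => ((x : sphere (0 : E) 1) : E))

/-- An orthonormal base of the subspace `M`: an orthonormal system in `M` such that
`v = ∑ (v, x) x` for every `v ∈ M`. (Mathlib's inner product is linear in the right argument, so
the coefficient `(v, x)` is `inner 𝕜 x v`.) -/
def IsONBOf {𝕜 E : Type*} [RCLike 𝕜] [NormedAddCommGroup E] [InnerProductSpace 𝕜 E]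
    (M : Submodule 𝕜 E) (A : Set (sphere (0 : E) 1)) : Prop :=
  IsONS 𝕜 A ∧ (∀ x ∈ A, (x : E) ∈ M) ∧
    ∀ v ∈ M, HasSum (fun x : A => inner 𝕜 ((x : sphere (0 : E) 1) : E) v •
      ((x : sphere (0 : E) 1) : E)) v

/-- A frame function: for every closed subspace `M` there is a weight `W` in `[-∞, ∞]` such that
`∑ f(x) = W` over every orthonormal base of `M`. -/
def IsFrameFunction (𝕜 : Type*) {E : Type*} [RCLike 𝕜] [NormedAddCommGroup E]
    [InnerProductSpace 𝕜 E] (f : sphere (0 : E) 1 → EReal) : Prop :=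
  ∀ M : Submodule 𝕜 E, IsClosed (M : Set E) →
    ∃ W : EReal, ∀ A : Set (sphere (0 : E) 1), IsONBOf M A → HasExtSum (fun x : A => f x) W

/-- The restriction of a function on the unit sphere of `E` to the unit sphere of a subspace. -/
def restrictSphere {𝕜 E : Type*} [RCLike 𝕜] [NormedAddCommGroup E] [InnerProductSpace 𝕜 E]
    (f : sphere (0 : E) 1 → EReal) (K : Submodule 𝕜 E) : sphere (0 : K) 1 → EReal :=
  fun x => f ⟨((x : K) : E), mem_sphere_zero_iff_norm.2 (mem_sphere_zero_iff_norm.1 x.2)⟩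

/-- A frame type function on (the unit sphere of) the inner product space `E`; this is used for
`E` a dense linear submanifold of a Hilbert space. -/
structure IsFrameTypeFunction (𝕜 : Type*) {E : Type*} [RCLike 𝕜] [NormedAddCommGroup E]
    [InnerProductSpace 𝕜 E] (f : sphere (0 : E) 1 → EReal) : Prop where
  summable_or_top : ∀ A : Set (sphere (0 : E) 1), IsONS 𝕜 A →
    (∃ r : ℝ, HasExtSum (fun x : A => f x) (r : EReal)) ∨ HasExtSum (fun x : A => f x) ⊤
  frame : ∀ K : Submodule 𝕜 E, FiniteDimensional 𝕜 K → IsFrameFunction 𝕜 (restrictSphere f K)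

/-- `f` is finite: `-∞ < f(x) < ∞` for every unit vector `x`. -/
def IsFiniteOnSphere {E : Type*} [NormedAddCommGroup E] (f : sphere (0 : E) 1 → EReal) : Prop :=
  ∀ x, ⊥ < f x ∧ f x < ⊤

/-- `f` is semibounded: `inf f > -∞` over the unit sphere. -/
def IsSemiboundedOnSphere {E : Type*} [NormedAddCommGroup E]
    (f : sphere (0 : E) 1 → EReal) : Prop :=
  ⊥ < ⨅ x, f x

/-- A form with domain `E`, linear in the left and antilinear in the right argument, is symmetric
if `t(x, y)` is the conjugate of `t(y, x)`. -/
def IsSymmetricForm {𝕜 E : Type*} [RCLike 𝕜] [NormedAddCommGroup E] [InnerProductSpace 𝕜 E]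
    (t : E →ₗ[𝕜] E →ₗ⋆[𝕜] 𝕜) : Prop :=
  ∀ x y, t x y = starRingEnd 𝕜 (t y x)

/-- A symmetric form is semibounded if `inf t(x, x) > -∞` over the unit sphere of its domain
(`t(x, x)` is a real number by symmetry). -/
def IsSemiboundedForm {𝕜 E : Type*} [RCLike 𝕜] [NormedAddCommGroup E] [InnerProductSpace 𝕜 E]
    (t : E →ₗ[𝕜] E →ₗ⋆[𝕜] 𝕜) : Prop :=
  ⊥ < ⨅ x : sphere (0 : E) 1, ((RCLike.re (t x x) : ℝ) : EReal)

/-! Extend f to nonzero vectors by homogeneity of degree zero and put N(x) = ‖x‖² f(x/‖x‖). The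
claim is that N is the diagonal of a Hermitian form; t is then its polarization. As dim H ≠ 2 and S
is dense, every orthonormal pair of S extends to an orthonormal triple in S, so on the real span of
an orthogonal pair N is controlled by Gleason's theorem for frame functions bounded below on real
three-space.

That theorem has two stages. First, continuity (`IsFrame3.continuousAt`): put the pole where F is
almost minimal and add to F its quarter turn, so that the sum is constant on the equator. Such a sum
almost decreases along great circles descending from their northernmost point, and two descents lead
from a whole open set to one near-minimal point. Hence the oscillation is small somewhere, and
quarter turns in suitable planes carry this everywhere. Second, integrate F over the ball against
the squared inner product with a unit vector s. Averaging about the axis s does not change the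
integral, and the average is affine in the squared height (`IsFrame3.zonal_eq`). So the integral
equals λF(s) + μW with λ > 0 (`frameEigenvalue_pos`), and solving for F(s) gives an expression
quadratic in s (`IsFrame3.norm_sq_mul_eq`).

Back in S, real quadraticity on orthogonal pairs together with N(cx) = |c|²N(x) makes N Hermitian on
every pair (`IsPhaseQuadratic.eq_zero`), and the parallelogram law makes the polarization additive.
Uniqueness holds because a symmetric form with zero diagonal vanishes. -/

/-- Euclidean three-space. -/
abbrev E3 : Type := EuclideanSpace ℝ (Fin 3)

/-! ### Frame functions on three-space and the cross product. -/

open Filter Topology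

/-- A function on nonzero vectors of three-space whose sum over every orthogonal triple is `W`. -/
def IsFrame3 (F : E3 → ℝ) (W : ℝ) : Prop :=
  ∀ u v w : E3, u ≠ 0 → v ≠ 0 → w ≠ 0 → inner ℝ u v = 0 → inner ℝ u w = 0 → inner ℝ v w = 0 →
    F u + F v + F w = W

/-- The cross3 product on Euclidean three-space. -/
def cross3 (u v : E3) : E3 :=
  !₂[u 1 * v 2 - u 2 * v 1, u 2 * v 0 - u 0 * v 2, u 0 * v 1 - u 1 * v 0]

theorem inner_E3 (u v : E3) : inner ℝ u v = u 0 * v 0 + u 1 * v 1 + u 2 * v 2 := by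
  simp [PiLp.inner_apply, Fin.sum_univ_three, mul_comm]

theorem ext_E3 {u v : E3} (h0 : u 0 = v 0) (h1 : u 1 = v 1) (h2 : u 2 = v 2) : u = v := by
  ext i; fin_cases i <;> assumption

theorem cross3_inner_left (u v : E3) : inner ℝ (cross3 u v) u = 0 := by
  rw [inner_E3]; simp [cross3]; ring

theorem cross3_inner_right (u v : E3) : inner ℝ (cross3 u v) v = 0 := by
  rw [inner_E3]; simp [cross3]; ring

theorem cross3_inner_left' (u v : E3) : inner ℝ u (cross3 u v) = 0 := by
  rw [real_inner_comm]; exact cross3_inner_left u v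

theorem cross3_inner_right' (u v : E3) : inner ℝ v (cross3 u v) = 0 := by
  rw [real_inner_comm]; exact cross3_inner_right u v

theorem cross3_cross (u v w : E3) :
    cross3 u (cross3 v w) = (inner ℝ u w) • v - (inner ℝ u v) • w := by
  apply ext_E3 <;> simp [cross3, inner_E3] <;> ring

theorem cross3_cross3_same (u v w : E3) :
    cross3 (cross3 u v) (cross3 u w) = (inner ℝ u (cross3 v w)) • u := by
  apply ext_E3 <;> simp [cross3, inner_E3] <;> ring

theorem cross3_smul_left (a : ℝ) (u v : E3) : cross3 (a • u) v = a • cross3 u v := by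
  apply ext_E3 <;> simp [cross3] <;> ring

theorem cross3_add_smul_right (a : ℝ) (u v : E3) :
    cross3 u (u + a • v) = a • cross3 u v := by
  apply ext_E3 <;> simp [cross3] <;> ring

theorem inner_cross3_self (u v : E3) :
    inner ℝ (cross3 u v) (cross3 u v) = inner ℝ u u * inner ℝ v v - inner ℝ u v ^ 2 := by
  simp only [inner_E3]; simp [cross3]; ring

theorem cross3_ne_zero {u v : E3} (hu : u ≠ 0) (hv : v ≠ 0) (h : inner ℝ u v = 0) :
    cross3 u v ≠ 0 := by
  intro h0
  have := inner_cross3_self u v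
  rw [h0, h] at this
  have h1 : (inner ℝ u u : ℝ) ≠ 0 := inner_self_ne_zero.2 hu
  have h2 : (inner ℝ v v : ℝ) ≠ 0 := inner_self_ne_zero.2 hv
  simp at this
  tauto

theorem continuous_cross3 : Continuous fun p : E3 × E3 => cross3 p.1 p.2 := by
  unfold cross3
  apply (PiLp.continuous_toLp 2 _).comp
  apply continuous_pi
  intro i
  fin_cases i <;> simp <;> fun_prop

theorem Filter.Tendsto.cross3 {ι : Type*} {l : Filter ι} {f g : ι → E3} {a b : E3}
    (hf : Tendsto f l (𝓝 a)) (hg : Tendsto g l (𝓝 b)) :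
    Tendsto (fun i => cross3 (f i) (g i)) l (𝓝 (cross3 a b)) :=
  (continuous_cross3.tendsto (a, b)).comp (hf.prodMk_nhds hg)

theorem exists_ne_zero_orthogonal (p q : E3) :
    ∃ r : E3, r ≠ 0 ∧ inner ℝ p r = 0 ∧ inner ℝ q r = 0 := by
  have hlt : Module.finrank ℝ (ℝ × ℝ) < Module.finrank ℝ E3 := by simp
  have hk := LinearMap.ker_ne_bot_of_finrank_lt
    (f := LinearMap.prod (innerₛₗ ℝ p) (innerₛₗ ℝ q)) hlt
  obtain ⟨r, hr, hr0⟩ := (Submodule.ne_bot_iff _).1 hk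
  refine ⟨r, hr0, ?_, ?_⟩
  · simpa using congrArg Prod.fst (LinearMap.mem_ker.1 hr)
  · simpa using congrArg Prod.snd (LinearMap.mem_ker.1 hr)

namespace IsFrame3

variable {F G : E3 → ℝ} {W W' : ℝ}

theorem pair_eq (hF : IsFrame3 F W) {n u u' v v' : E3} (hn : n ≠ 0) (hu : u ≠ 0) (hu' : u' ≠ 0)
    (hv : v ≠ 0) (hv' : v' ≠ 0) (hnu : inner ℝ n u = 0) (hnu' : inner ℝ n u' = 0)
    (hnv : inner ℝ n v = 0) (hnv' : inner ℝ n v' = 0) (huu : inner ℝ u u' = 0)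
    (hvv : inner ℝ v v' = 0) : F u + F u' = F v + F v' := by
  linarith [hF n u u' hn hu hu' hnu hnu' huu, hF n v v' hn hv hv' hnv hnv' hvv]

/-- Both u and c • u are completed to an orthogonal triple by the same two vectors. -/
theorem smul_eq (hF : IsFrame3 F W) (u : E3) {c : ℝ} (hc : c ≠ 0) : F (c • u) = F u := by
  by_cases hu : u = 0
  · simp [hu]
  obtain ⟨v, hv, huv, -⟩ := exists_ne_zero_orthogonal u u
  have hw := cross3_ne_zero hu hv huv
  have h1 := hF u v _ hu hv hw huv (cross3_inner_left' u v) (cross3_inner_right' u v)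
  have h2 := hF (c • u) v _ (smul_ne_zero hc hu) hv hw (by simp [inner_smul_left, huv])
    (by simp [inner_smul_left, cross3_inner_left' u v]) (cross3_inner_right' u v)
  linarith

theorem neg_eq (hF : IsFrame3 F W) (u : E3) : F (-u) = F u := by
  rw [← hF.smul_eq u (neg_ne_zero.2 one_ne_zero)]; simp

theorem comp_isometry (hF : IsFrame3 F W) (L : E3 ≃ₗᵢ[ℝ] E3) : IsFrame3 (F ∘ L) W := by
  intro u v w hu hv hw h1 h2 h3
  apply hF <;> simpa

theorem add (hF : IsFrame3 F W) (hG : IsFrame3 G W') :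
    IsFrame3 (fun x => F x + G x) (W + W') := by
  intro u v w hu hv hw h1 h2 h3
  linarith [hF u v w hu hv hw h1 h2 h3, hG u v w hu hv hw h1 h2 h3]

theorem sub_const (hF : IsFrame3 F W) (m : ℝ) : IsFrame3 (fun x => F x - m) (W - 3 * m) := by
  intro u v w hu hv hw h1 h2 h3
  linarith [hF u v w hu hv hw h1 h2 h3]

theorem le_of_le (hF : IsFrame3 F W) {m : ℝ} (hm : ∀ v ≠ 0, m ≤ F v) {v : E3} (hv : v ≠ 0) :
    F v ≤ W - 2 * m := by
  obtain ⟨u, hu, hvu, -⟩ := exists_ne_zero_orthogonal v v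
  have hw := cross3_ne_zero hv hu hvu
  linarith [hF v u _ hv hu hw hvu (cross3_inner_left' v u) (cross3_inner_right' v u), hm u hu,
    hm _ hw]

end IsFrame3

/-! ### Oscillation and its transport between directions. -/

/-- The oscillation of `F` at `p` is at most `α`. -/
def OscLE (F : E3 → ℝ) (p : E3) (α : ℝ) : Prop :=
  ∃ U ∈ 𝓝 p, ∀ x ∈ U, ∀ y ∈ U, |F x - F y| ≤ α

theorem OscLE.of_comp {F : E3 → ℝ} {p : E3} {α : ℝ} (L : E3 ≃ₗᵢ[ℝ] E3)
    (h : OscLE (F ∘ L) p α) : OscLE F (L p) α := by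
  obtain ⟨U, hU, h⟩ := h
  refine ⟨L.symm ⁻¹' U, L.symm.continuous.continuousAt (by simpa using hU), ?_⟩
  intro x hx y hy
  simpa using h _ hx _ hy

/-- If `z` is close to `c • q` and the plane of `q` and `p` is close to the plane `n ^ ⊥`, where
`p ⊥ q`, then the vector of that plane orthogonal to `z` is close to a multiple of `p`. -/
theorem IsFrame3.abs_sub_le_of_plane {F : E3 → ℝ} {W : ℝ} (hF : IsFrame3 F W) {U : Set E3} {α : ℝ}
    (hosc : ∀ x ∈ U, ∀ y ∈ U, |F x - F y| ≤ α) {x z n : E3} {a b : ℝ} (ha : a ≠ 0) (hb : b ≠ 0)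
    (hx : x ≠ 0) (hz : z ≠ 0) (hn : n ≠ 0) (hnx : inner ℝ n x = 0) (hnz : inner ℝ n z = 0)
    (hxU : a • cross3 x n ∈ U) (hzU : b • cross3 z n ∈ U) : |F x - F z| ≤ α := by
  have h := hF.pair_eq hn hx (cross3_ne_zero hx hn (by rw [real_inner_comm]; exact hnx)) hz
    (cross3_ne_zero hz hn (by rw [real_inner_comm]; exact hnz)) hnx (cross3_inner_right' _ _) hnz
    (cross3_inner_right' _ _) (cross3_inner_left' _ _) (cross3_inner_left' _ _)
  have h2 := hosc _ hzU _ hxU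
  rw [hF.smul_eq _ ha, hF.smul_eq _ hb] at h2
  rwa [show F x - F z = F (cross3 z n) - F (cross3 x n) by linarith]

/-- For x, y near q, the plane of x and p meets the plane of y and a second direction p₂ near p in a
line spanned by some z, close to the line of q. A quarter turn inside the first plane replaces F x -
F z by a difference of values near p; the second plane does the same for F y - F z near p₂. Each
costs at most α. -/
theorem IsFrame3.oscLE_of_inner_eq_zero {F : E3 → ℝ} {W : ℝ} (hF : IsFrame3 F W) {p q : E3}
    {α : ℝ} (hp : p ≠ 0) (hq : q ≠ 0) (hpq : inner ℝ p q = 0) (h : OscLE F p α) :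
    OscLE F q (2 * α) := by
  obtain ⟨U, hU, hosc⟩ := h
  have hqp : inner ℝ q p = 0 := by rw [real_inner_comm]; exact hpq
  have hpp : inner ℝ p p ≠ (0 : ℝ) := inner_self_ne_zero.2 hp
  have hqq : inner ℝ q q ≠ (0 : ℝ) := inner_self_ne_zero.2 hq
  -- a second direction in `U`, orthogonal to `q` as well
  obtain ⟨ε, hε, hεU⟩ : ∃ ε : ℝ, ε ≠ 0 ∧ p + ε • cross3 p q ∈ interior U := by
    have ht : Tendsto (fun ε : ℝ => p + ε • cross3 p q) (𝓝[≠] 0) (𝓝 p) := by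
      have : Continuous fun ε : ℝ => p + ε • cross3 p q := by fun_prop
      simpa using (this.tendsto 0).mono_left nhdsWithin_le_nhds
    obtain ⟨ε, h1, h2⟩ := ((ht.eventually (interior_mem_nhds.2 hU)).and
      self_mem_nhdsWithin).exists
    exact ⟨ε, h2, h1⟩
  set p₂ := p + ε • cross3 p q with hp₂
  have hqp₂ : inner ℝ q p₂ = 0 := by
    rw [hp₂, inner_add_right, inner_smul_right, hqp, cross3_inner_right']; simp
  have hU₂ : U ∈ 𝓝 p₂ := mem_interior_iff_mem_nhds.1 hεU
  -- In the limit the two planes meet exactly in the line of q: p, p₂ and q are independent since ε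
  -- ≠ 0, which makes the factor c nonzero.
  have hlim : cross3 (cross3 q p) (cross3 q p₂) = (-(ε * inner ℝ p p * inner ℝ q q)) • q := by
    rw [cross3_cross3_same, hp₂, cross3_add_smul_right, cross3_cross, hpq, inner_smul_right,
      zero_smul, zero_sub, inner_neg_right, inner_smul_right]
    congr 1; ring
  set c : ℝ := -(ε * inner ℝ p p * inner ℝ q q) with hc
  have hc0 : c ≠ 0 := by rw [hc]; simp [hε, hp, hq]
  have hperp : ∀ r : E3, inner ℝ q r = 0 → cross3 q (cross3 q r) = (-(inner ℝ q q : ℝ)) • r := by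
    intro r hr
    rw [cross3_cross, hr]; simp
  have hp₂0 : p₂ ≠ 0 := by
    intro h0
    have : inner ℝ p p₂ = inner ℝ p p := by
      rw [hp₂, inner_add_right, inner_smul_right, cross3_inner_left']; simp
    rw [h0, inner_zero_right] at this; exact hpp this.symm
  have tx : Tendsto (fun v : E3 × E3 => v.1) (𝓝 q ×ˢ 𝓝 q) (𝓝 q) := tendsto_fst
  have ty : Tendsto (fun v : E3 × E3 => v.2) (𝓝 q ×ˢ 𝓝 q) (𝓝 q) := tendsto_snd
  have tn : Tendsto (fun v : E3 × E3 => cross3 v.1 p) (𝓝 q ×ˢ 𝓝 q) (𝓝 (cross3 q p)) :=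
    tx.cross3 tendsto_const_nhds
  have tn₂ : Tendsto (fun v : E3 × E3 => cross3 v.2 p₂) (𝓝 q ×ˢ 𝓝 q) (𝓝 (cross3 q p₂)) :=
    ty.cross3 tendsto_const_nhds
  have tz := tn.cross3 tn₂
  rw [hlim] at tz
  have a0 : (-(inner ℝ q q : ℝ))⁻¹ ≠ 0 := inv_ne_zero (neg_ne_zero.2 hqq)
  have b0 : (c * -(inner ℝ q q : ℝ))⁻¹ ≠ 0 := inv_ne_zero (mul_ne_zero hc0 (neg_ne_zero.2 hqq))
  have t1 := (tx.cross3 tn).const_smul (-(inner ℝ q q : ℝ))⁻¹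
  have t2 := (tz.cross3 tn).const_smul (c * -(inner ℝ q q : ℝ))⁻¹
  have t3 := (ty.cross3 tn₂).const_smul (-(inner ℝ q q : ℝ))⁻¹
  have t4 := (tz.cross3 tn₂).const_smul (c * -(inner ℝ q q : ℝ))⁻¹
  rw [hperp _ hqp, inv_smul_smul₀ (neg_ne_zero.2 hqq)] at t1
  rw [hperp _ hqp₂, inv_smul_smul₀ (neg_ne_zero.2 hqq)] at t3
  rw [cross3_smul_left, hperp _ hqp, smul_smul c,
    inv_smul_smul₀ (mul_ne_zero hc0 (neg_ne_zero.2 hqq))] at t2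
  rw [cross3_smul_left, hperp _ hqp₂, smul_smul c,
    inv_smul_smul₀ (mul_ne_zero hc0 (neg_ne_zero.2 hqq))] at t4
  have ev : ∀ᶠ v : E3 × E3 in 𝓝 q ×ˢ 𝓝 q, |F v.1 - F v.2| ≤ 2 * α := by
    filter_upwards [t1.eventually hU, t2.eventually hU, t3.eventually hU₂, t4.eventually hU₂,
      tx.eventually_ne hq, ty.eventually_ne hq, tz.eventually_ne (smul_ne_zero hc0 hq),
      tn.eventually_ne (cross3_ne_zero hq hp hqp), tn₂.eventually_ne (cross3_ne_zero hq hp₂0 hqp₂)]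
      with v h1 h2 h3 h4 hx hy hz hn hn₂
    have e1 := hF.abs_sub_le_of_plane hosc a0 b0 hx hz hn (cross3_inner_left _ _)
      (cross3_inner_left' _ _) h1 h2
    have e2 := hF.abs_sub_le_of_plane hosc a0 b0 hy hz hn₂ (cross3_inner_left _ _)
      (cross3_inner_right' _ _) h3 h4
    rw [abs_le] at e1 e2 ⊢
    constructor <;> linarith [e1.1, e1.2, e2.1, e2.2]
  obtain ⟨V, hV, hVs⟩ := mem_prod_same_iff.1 ev
  exact ⟨V, hV, fun x hx y hy => hVs (Set.mk_mem_prod hx hy)⟩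

/-- Two directions always have a common orthogonal one, so two transports suffice. -/
theorem IsFrame3.oscLE_of_oscLE {F : E3 → ℝ} {W : ℝ} (hF : IsFrame3 F W) {p q : E3}
    {α : ℝ} (hp : p ≠ 0) (hq : q ≠ 0) (h : OscLE F p α) : OscLE F q (4 * α) := by
  obtain ⟨r, hr, hpr, hqr⟩ := exists_ne_zero_orthogonal p q
  have := hF.oscLE_of_inner_eq_zero hr hq (by rw [real_inner_comm]; exact hqr)
    (hF.oscLE_of_inner_eq_zero hp hr hpr h)
  rwa [show 2 * (2 * α) = 4 * α by ring] at this

/-! ### The pole and rotations about the vertical axis. -/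

/-- The north pole of three-space. -/
def northPole : E3 := !₂[0, 0, 1]

@[simp] theorem northPole_zero : northPole 0 = 0 := rfl
@[simp] theorem northPole_one : northPole 1 = 0 := rfl
@[simp] theorem northPole_two : northPole 2 = 1 := rfl

theorem northPole_ne_zero : northPole ≠ 0 := fun h => by
  have := congrArg (fun v : E3 => v 2) h
  simp at this

theorem norm_northPole : ‖northPole‖ = 1 := by
  simp [EuclideanSpace.norm_eq, Fin.sum_univ_three]

/-- The rotation about the vertical axis by the angle `θ`. -/
noncomputable def rotZ (θ : ℝ) : E3 ≃ₗᵢ[ℝ] E3 :=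
  LinearIsometry.toLinearIsometryEquiv
    { toFun := fun v => !₂[Real.cos θ * v 0 - Real.sin θ * v 1,
        Real.sin θ * v 0 + Real.cos θ * v 1, v 2]
      map_add' := fun u v => by apply ext_E3 <;> simp <;> ring
      map_smul' := fun c v => by apply ext_E3 <;> simp <;> ring
      norm_map' := fun v => by
        simp only [LinearMap.coe_mk, AddHom.coe_mk, EuclideanSpace.norm_eq, Fin.sum_univ_three]
        congr 1
        simp
        linear_combination (v 0 ^ 2 + v 1 ^ 2) * Real.sin_sq_add_cos_sq θ } rfl

@[simp] theorem rotZ_zero (θ : ℝ) (v : E3) :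
    rotZ θ v 0 = Real.cos θ * v 0 - Real.sin θ * v 1 := rfl
@[simp] theorem rotZ_one (θ : ℝ) (v : E3) :
    rotZ θ v 1 = Real.sin θ * v 0 + Real.cos θ * v 1 := rfl
@[simp] theorem rotZ_two (θ : ℝ) (v : E3) : rotZ θ v 2 = v 2 := rfl

theorem ne_zero_E3_iff {v : E3} : v ≠ 0 ↔ v 0 ≠ 0 ∨ v 1 ≠ 0 ∨ v 2 ≠ 0 := by
  rw [← not_iff_not]
  push Not
  exact ⟨fun h => by simp [h], fun ⟨h0, h1, h2⟩ => ext_E3 h0 h1 h2⟩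

theorem cross3_northPole_ne_zero {x : E3} (h : x 0 ≠ 0 ∨ x 1 ≠ 0) : cross3 northPole x ≠ 0 := by
  rw [ne_zero_E3_iff]
  simp [cross3]
  tauto

/-! ### Frame functions constant on the equator: descent along great circles. -/

section Descent

variable {G : E3 → ℝ} {W c δ : ℝ}

/-- On the meridian through x, the value at x plus the nonnegative value at its perpendicular equals
the value at the pole plus c. -/
theorem IsFrame3.le_equator_add (hG : IsFrame3 G W) (hpos : ∀ v ≠ 0, 0 ≤ G v)
    (hpole : G northPole ≤ δ) (heq : ∀ v ≠ 0, v 2 = 0 → G v = c) {x : E3} (hx : x ≠ 0) :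
    G x ≤ c + δ := by
  have hδ : 0 ≤ δ := (hpos _ northPole_ne_zero).trans hpole
  by_cases h2 : x 2 = 0
  · rw [heq x hx h2]; linarith
  by_cases h01 : x 0 ≠ 0 ∨ x 1 ≠ 0
  · have hn := cross3_northPole_ne_zero h01
    set n := cross3 northPole x with hn_def
    have hnx : inner ℝ n x = 0 := cross3_inner_right _ _
    have hnp : inner ℝ n northPole = 0 := cross3_inner_left _ _
    have h := hG.pair_eq hn hx (cross3_ne_zero hn hx hnx) northPole_ne_zero
      (cross3_ne_zero hn northPole_ne_zero hnp) hnx (cross3_inner_left' _ _) hnp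
      (cross3_inner_left' _ _) (cross3_inner_right' _ _) (cross3_inner_right' _ _)
    have h3 := heq _ (cross3_ne_zero hn northPole_ne_zero hnp) (by simp [cross3])
    linarith [hpos _ (cross3_ne_zero hn hx hnx)]
  · push Not at h01
    have : x = x 2 • northPole := by apply ext_E3 <;> simp [h01.1, h01.2]
    rw [this, hG.smul_eq _ h2]
    have hc : 0 ≤ c := by
      rw [← heq (!₂[1, 0, 0]) (ne_zero_E3_iff.2 (by simp)) rfl]
      exact hpos _ (ne_zero_E3_iff.2 (by simp))
    linarith

/-- Descending along the great circle through `x` whose northernmost point is `x`, the value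
decreases by at most `δ`. -/
theorem IsFrame3.le_descend (hG : IsFrame3 G W) (hpos : ∀ v ≠ 0, 0 ≤ G v)
    (hpole : G northPole ≤ δ) (heq : ∀ v ≠ 0, v 2 = 0 → G v = c) {x : E3} (hx : x 0 ≠ 0 ∨ x 1 ≠ 0)
    (t : ℝ) : G x ≤ G (x + t • cross3 northPole x) + δ := by
  have hx0 : x ≠ 0 := ne_zero_E3_iff.2 (by tauto)
  have he := cross3_northPole_ne_zero hx
  set e := cross3 northPole x with he_def
  have hxe : inner ℝ x e = 0 := cross3_inner_right' _ _
  have hn := cross3_ne_zero hx0 he hxe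
  set n := cross3 x e with hn_def
  have hnx : inner ℝ n x = 0 := cross3_inner_left _ _
  have hne : inner ℝ n e = 0 := cross3_inner_right _ _
  have hny : inner ℝ n (x + t • e) = 0 := by
    rw [inner_add_right, inner_smul_right, hnx, hne]; simp
  have hy : x + t • e ≠ 0 := by
    intro h0
    have : inner ℝ x (x + t • e) = inner ℝ x x := by
      rw [inner_add_right, inner_smul_right, hxe]; simp
    rw [h0, inner_zero_right] at this
    exact hx0 (inner_self_eq_zero.1 this.symm)
  -- Within one plane the pair x, e and the pair formed by x + t • e and its perpendicular have
  -- equal sums. Here e is on the equator, with value c, and the perpendicular has value at most c +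
  -- δ.
  have h := hG.pair_eq hn hx0 he hy (cross3_ne_zero hn hy hny) hnx hne hny
    (cross3_inner_left' _ _) hxe (cross3_inner_right' _ _)
  have h1 := hG.le_equator_add hpos hpole heq (cross3_ne_zero hn hy hny)
  have h2 := heq e he (by simp [he_def, cross3])
  linarith

/-- Read the horizontal part of a vector as a complex number. A descent with parameter s multiplies
it by 1 + is and keeps the height, so two descents multiply it by (1 - st) + i(s + t). This equals A
+ iB for real s, t exactly when the discriminant B² - 4(1 - A) is nonnegative. -/
theorem IsFrame3.le_descend_twice (hG : IsFrame3 G W) (hpos : ∀ v ≠ 0, 0 ≤ G v)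
    (hpole : G northPole ≤ δ) (heq : ∀ v ≠ 0, v 2 = 0 → G v = c) {x z : E3}
    (hx : x 0 ≠ 0 ∨ x 1 ≠ 0) (h2 : z 2 = x 2) {A B : ℝ} (h0 : z 0 = A * x 0 - B * x 1)
    (h1 : z 1 = B * x 0 + A * x 1) (hAB : 0 ≤ B ^ 2 + 4 * A - 4) : G x ≤ G z + 2 * δ := by
  set r := Real.sqrt (B ^ 2 + 4 * A - 4)
  have hr : r ^ 2 = B ^ 2 + 4 * A - 4 := Real.sq_sqrt hAB
  set y := x + ((B + r) / 2) • cross3 northPole x with hy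
  have y0 : y 0 = x 0 - (B + r) / 2 * x 1 := by simp [hy, cross3]; ring
  have y1 : y 1 = x 1 + (B + r) / 2 * x 0 := by simp [hy, cross3]
  have hy01 : y 0 ≠ 0 ∨ y 1 ≠ 0 := by
    by_contra hcon
    push Not at hcon
    rw [y0, y1] at hcon
    have : (x 0 ^ 2 + x 1 ^ 2) * (1 + ((B + r) / 2) ^ 2) = 0 := by
      linear_combination (x 0 - (B + r) / 2 * x 1) * hcon.1 + (x 1 + (B + r) / 2 * x 0) * hcon.2
    have hp : 0 < 1 + ((B + r) / 2) ^ 2 := by positivity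
    have : x 0 ^ 2 + x 1 ^ 2 = 0 := by simpa [hp.ne'] using this
    rcases hx with h | h
    · have := pow_pos (abs_pos.2 h) 2; rw [sq_abs] at this; nlinarith [sq_nonneg (x 1)]
    · have := pow_pos (abs_pos.2 h) 2; rw [sq_abs] at this; nlinarith [sq_nonneg (x 0)]
  have hz : z = y + ((B - r) / 2) • cross3 northPole y := by
    apply ext_E3
    · simp [cross3, y0, y1, h0]; linear_combination (-x 0 / 4) * hr
    · simp [cross3, y0, y1, h1]; linear_combination (-x 1 / 4) * hr
    · simp [cross3, h2, hy]
  have e1 := hG.le_descend hpos hpole heq hx ((B + r) / 2)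
  have e2 := hG.le_descend hpos hpole heq hy01 ((B - r) / 2)
  rw [← hy] at e1
  rw [← hz] at e2
  linarith

/-- Near-minimality of y bounds G below by G y - δ on `V`; two descents to a multiple of y bound it
above by G y + 2δ near a suitable q. The oscillation 3δ at q becomes 12δ at the pole. -/
theorem IsFrame3.oscLE_of_equator (hG : IsFrame3 G W) (hpos : ∀ v ≠ 0, 0 ≤ G v)
    (hpole : G northPole ≤ δ) (heq : ∀ v ≠ 0, v 2 = 0 → G v = c) (hδ : 0 < δ) :
    OscLE G northPole (12 * δ) := by
  let V : Set E3 := {v | v 2 ≠ 0 ∧ v 0 ^ 2 + v 1 ^ 2 ≠ 0}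
  have hV0 : ∀ v ∈ V, v ≠ 0 := fun v hv => ne_zero_E3_iff.2 (Or.inr (Or.inr hv.1))
  have hV01 : ∀ v ∈ V, v 0 ≠ 0 ∨ v 1 ≠ 0 := by
    intro v hv
    by_contra hcon
    push Not at hcon
    exact hv.2 (by simp [hcon.1, hcon.2])
  have hne : (G '' V).Nonempty := ⟨_, !₂[1, 0, 1], by constructor <;> simp, rfl⟩
  obtain ⟨_, ⟨y, hyV, rfl⟩, hy⟩ := exists_lt_of_csInf_lt hne (lt_add_of_pos_right _ hδ)
  have hbdd : BddBelow (G '' V) := ⟨0, by rintro _ ⟨v, hv, rfl⟩; exact hpos v (hV0 v hv)⟩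
  have hmin : ∀ v ∈ V, G y ≤ G v + δ := fun v hv => by
    linarith [csInf_le hbdd (Set.mem_image_of_mem G hv)]
  -- Halving the horizontal part of y makes the required multiplier at q equal to 2, where the
  -- discriminant is 4; its positivity persists nearby.
  let q : E3 := !₂[y 0 / 2, y 1 / 2, y 2]
  have q0 : q 0 = y 0 / 2 := rfl
  have q1 : q 1 = y 1 / 2 := rfl
  have q2 : q 2 = y 2 := rfl
  have hqs : q 0 ^ 2 + q 1 ^ 2 ≠ 0 := by
    rw [q0, q1]; intro h; exact hyV.2 (by linarith)
  have hq0 : q ≠ 0 := ne_zero_E3_iff.2 (Or.inr (Or.inr hyV.1))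
  -- A + iB is the quotient of the horizontal parts of (x₂/y₂) • y and x; descents keep the height,
  -- so y is first scaled to the height of x.
  let A : E3 → ℝ := fun x => (x 2 / y 2) * (y 0 * x 0 + y 1 * x 1) / (x 0 ^ 2 + x 1 ^ 2)
  let B : E3 → ℝ := fun x => (x 2 / y 2) * (y 1 * x 0 - y 0 * x 1) / (x 0 ^ 2 + x 1 ^ 2)
  have hcont : ContinuousAt (fun x => B x ^ 2 + 4 * A x - 4) q := by
    have h1 : ContinuousAt B q := ContinuousAt.div (by fun_prop) (by fun_prop) hqs
    have h2 : ContinuousAt A q := ContinuousAt.div (by fun_prop) (by fun_prop) hqs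
    fun_prop
  have hval : 0 < B q ^ 2 + 4 * A q - 4 := by
    have hA : A q = 2 := by
      simp only [A]
      rw [div_eq_iff hqs, q0, q1, q2, div_self hyV.1]; ring
    have hB : B q = 0 := by simp only [B, q0, q1]; ring
    rw [hA, hB]; norm_num
  have hev : ∀ᶠ x in 𝓝 q, x ∈ V ∧ 0 < B x ^ 2 + 4 * A x - 4 := by
    refine Filter.Eventually.and (Filter.Eventually.and ?_ ?_)
      (hcont.eventually (lt_mem_nhds hval))
    · exact ContinuousAt.eventually_ne (g := fun x : E3 => x 2) (by fun_prop) hyV.1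
    · exact ContinuousAt.eventually_ne (g := fun x : E3 => x 0 ^ 2 + x 1 ^ 2) (by fun_prop) hqs
  have hosc : OscLE G q (3 * δ) := by
    refine ⟨_, hev, ?_⟩
    have key : ∀ x, x ∈ V ∧ 0 < B x ^ 2 + 4 * A x - 4 → G x ≤ G y + 2 * δ := by
      rintro x ⟨hx, hAB⟩
      have h := hG.le_descend_twice (z := (x 2 / y 2) • y) hpos hpole heq (hV01 x hx)
        (by simp [hyV.1]) (A := A x) (B := B x) ?_ ?_ hAB.le
      · rwa [hG.smul_eq _ (div_ne_zero hx.1 hyV.1)] at h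
      · have := hx.2
        simp only [PiLp.smul_apply, smul_eq_mul, A, B]
        field_simp; ring
      · have := hx.2
        simp only [PiLp.smul_apply, smul_eq_mul, A, B]
        field_simp; ring
    intro x hx z hz
    rw [abs_le]
    constructor <;> linarith [key x hx, key z hz, hmin x hx.1, hmin z hz.1]
  have := hG.oscLE_of_oscLE hq0 northPole_ne_zero hosc
  rwa [show 4 * (3 * δ) = 12 * δ by ring] at this

end Descent

/-! ### Continuity of frame functions bounded below. -/

theorem exists_isometry_northPole {p : E3} (hp : ‖p‖ = 1) :
    ∃ L : E3 ≃ₗᵢ[ℝ] E3, L northPole = p :=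
  ⟨_, Submodule.reflection_sub (by rw [norm_northPole, hp])⟩

/-- A vector of the equator, its quarter turn and the pole form an orthogonal triple, so F plus its
quarter turn is constant on the equator. Near the pole this sum is at most δ + 12δ, and it dominates
F ≥ 0. -/
theorem IsFrame3.oscLE_northPole {F : E3 → ℝ} {W δ : ℝ} (hF : IsFrame3 F W)
    (hpos : ∀ v ≠ 0, 0 ≤ F v) (hδ : 0 < δ) (hpole : 2 * F northPole ≤ δ) :
    OscLE F northPole (13 * δ) := by
  have hG := hF.add (hF.comp_isometry (rotZ (Real.pi / 2)))
  have hσ : ∀ v ≠ 0, 0 ≤ F (rotZ (Real.pi / 2) v) := fun v hv => hpos _ (by simpa using hv)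
  have hfix : rotZ (Real.pi / 2) northPole = northPole := by apply ext_E3 <;> simp
  obtain ⟨U, hU, hosc⟩ := hG.oscLE_of_equator (c := W - F northPole) (δ := δ)
    (fun v hv => add_nonneg (hpos v hv) (hσ v hv))
    (by simp only [Function.comp, hfix]; linarith)
    (fun v hv h2 => by
      have := hF v (rotZ (Real.pi / 2) v) northPole hv (by simpa using hv) northPole_ne_zero
        (by simp [inner_E3, h2]; ring) (by simp [inner_E3, h2]) (by simp [inner_E3, h2])
      simp only [Function.comp]; linarith) hδ
  have hpU := mem_of_mem_nhds hU
  refine ⟨U ∩ {0}ᶜ, inter_mem hU (compl_singleton_mem_nhds northPole_ne_zero), ?_⟩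
  have key : ∀ x ∈ U ∩ {0}ᶜ, 0 ≤ F x ∧ F x ≤ 13 * δ := by
    rintro x ⟨hx, hx0⟩
    have h := (abs_le.1 (hosc x hx _ hpU)).2
    simp only [Function.comp, hfix] at h
    exact ⟨hpos x hx0, by linarith [hσ x hx0]⟩
  intro x hx y hy
  rw [abs_le]
  constructor <;> linarith [key x hx, key y hy]

/-- A frame function on three-space that is bounded below is continuous. -/
theorem IsFrame3.continuousAt {F : E3 → ℝ} {W m : ℝ} (hF : IsFrame3 F W)
    (hm : ∀ v ≠ 0, m ≤ F v) {v : E3} (hv : v ≠ 0) : ContinuousAt F v := by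
  have hbdd : BddBelow (F '' {0}ᶜ) := ⟨m, by rintro _ ⟨v, hv, rfl⟩; exact hm v hv⟩
  have hne : (F '' {0}ᶜ).Nonempty := ⟨_, _, northPole_ne_zero, rfl⟩
  rw [Metric.continuousAt_iff']
  intro ε hε
  -- The bound 13δ at the near-minimal direction becomes 4 · 13δ = 52δ at v, which is below ε.
  set δ := ε / 60 with hδ
  have hδ0 : 0 < δ := by positivity
  obtain ⟨_, ⟨p, hp0, rfl⟩, hp⟩ := exists_lt_of_csInf_lt hne
    (lt_add_of_pos_right (sInf (F '' {0}ᶜ)) (half_pos hδ0))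
  have hp0 : p ≠ 0 := hp0
  have hmin : ∀ v ≠ 0, sInf (F '' {0}ᶜ) ≤ F v :=
    fun v hv => csInf_le hbdd (Set.mem_image_of_mem F hv)
  set I := sInf (F '' {0}ᶜ)
  obtain ⟨L, hL⟩ := exists_isometry_northPole (p := ‖p‖⁻¹ • p) (by simp [norm_smul, hp0])
  have hFp : F (‖p‖⁻¹ • p) = F p := hF.smul_eq p (by simpa using hp0)
  have h1 := ((hF.sub_const I).comp_isometry L).oscLE_northPole (δ := δ)
    (fun v hv => by
      have := hmin (L v) (by simpa using hv)
      simpa using this) hδ0 (by simp only [Function.comp, hL, hFp]; linarith)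
  have h2 := (hF.sub_const I).oscLE_of_oscLE
    (by rw [hL]; exact smul_ne_zero (by simpa using hp0) hp0) hv h1.of_comp
  obtain ⟨U, hU, h⟩ := h2
  filter_upwards [hU] with x hx
  have := h x hx v (mem_of_mem_nhds hU)
  rw [sub_sub_sub_cancel_right] at this
  rw [Real.dist_eq]
  linarith

/-! ### Cauchy's equation and zonal frame functions. -/

open MeasureTheory

/-- A bounded solution of Cauchy's equation on the unit interval is affine. -/
theorem eq_affine_of_add_eq {φ : ℝ → ℝ} {C : ℝ} (hC : ∀ a, 0 ≤ a → a ≤ 1 → |φ a| ≤ C)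
    (hadd : ∀ a b, 0 ≤ a → 0 ≤ b → a + b ≤ 1 → φ a + φ b = φ (a + b) + φ 0) {a : ℝ}
    (h0 : 0 ≤ a) (h1 : a ≤ 1) : φ a = φ 0 + a * (φ 1 - φ 0) := by
  let χ : ℝ → ℝ := fun a => φ a - φ 0 - a * (φ 1 - φ 0)
  -- The deviation χ from the chord satisfies χ(2a) = 2χ(a), which halves the bound on [0, 1/2];
  -- χ(a) = -χ(1 - a) carries it to the other half.
  have hχ : ∀ n : ℕ, ∀ a, 0 ≤ a → a ≤ 1 → |χ a| ≤ 4 * C / 2 ^ n := by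
    intro n
    induction n with
    | zero =>
      intro a h0 h1
      have e0 := abs_le.1 (hC 0 le_rfl zero_le_one)
      have e1 := abs_le.1 (hC 1 zero_le_one le_rfl)
      have ea := abs_le.1 (hC a h0 h1)
      simp only [χ, pow_zero, div_one]
      rw [abs_le]
      constructor <;> nlinarith
    | succ n ih =>
      have half : ∀ a, 0 ≤ a → a ≤ 1 / 2 → |χ a| ≤ 4 * C / 2 ^ (n + 1) := by
        intro a h0 h1
        have h := ih (a + a) (by linarith) (by linarith)
        have e : χ (a + a) = 2 * χ a := by
          simp only [χ]; linarith [hadd a a h0 h0 (by linarith)]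
        rw [e, abs_mul, abs_two] at h
        rw [pow_succ, ← div_div]
        linarith
      intro a h0 h1
      rcases le_total a (1 / 2) with h | h
      · exact half a h0 h
      · have e : χ a = -χ (1 - a) := by
          have := hadd a (1 - a) h0 (by linarith) (by linarith)
          rw [add_sub_cancel] at this
          simp only [χ]; linarith
        rw [e, abs_neg]
        exact half _ (by linarith) (by linarith)
  have hlim : Tendsto (fun n : ℕ => 4 * C / 2 ^ n) atTop (𝓝 0) := by
    have := (tendsto_pow_atTop_nhds_zero_of_lt_one (r := (1 / 2 : ℝ)) (by norm_num)
      (by norm_num)).const_mul (4 * C)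
    simpa [div_eq_mul_inv] using this
  have hz : |χ a| ≤ 0 := ge_of_tendsto' hlim fun n => hχ n a h0 h1
  have := abs_nonpos_iff.1 hz
  simp only [χ] at this
  linarith

section Zonal

variable {G : E3 → ℝ} {W : ℝ}

theorem exists_rotZ_eq (v : E3) :
    ∃ a : ℝ, rotZ a v = !₂[Real.sqrt (v 0 ^ 2 + v 1 ^ 2), 0, v 2] := by
  let z : ℂ := ⟨v 0, v 1⟩
  have hz : Real.sqrt (v 0 ^ 2 + v 1 ^ 2) = ‖z‖ := by
    rw [Complex.norm_def, Complex.normSq_apply]; congr 1; simp [z]; ring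
  refine ⟨-z.arg, ?_⟩
  have h0 : v 0 = ‖z‖ * Real.cos z.arg := (Complex.norm_mul_cos_arg z).symm
  have h1 : v 1 = ‖z‖ * Real.sin z.arg := (Complex.norm_mul_sin_arg z).symm
  apply ext_E3
  · rw [rotZ_zero, Real.cos_neg, Real.sin_neg, hz]
    change _ = ‖z‖
    linear_combination Real.cos z.arg * h0 + Real.sin z.arg * h1 +
      ‖z‖ * Real.sin_sq_add_cos_sq z.arg
  · rw [rotZ_one, Real.cos_neg, Real.sin_neg]
    change _ = (0 : ℝ)
    linear_combination Real.cos z.arg * h1 - Real.sin z.arg * h0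
  · simp

/-- The sign of the height does not matter: the half turn followed by negation reverses it alone. -/
theorem IsFrame3.eq_of_rotZ_invariant (hG : IsFrame3 G W) (hrot : ∀ a v, G (rotZ a v) = G v)
    {v w : E3} (h01 : v 0 ^ 2 + v 1 ^ 2 = w 0 ^ 2 + w 1 ^ 2) (h2 : v 2 ^ 2 = w 2 ^ 2) :
    G v = G w := by
  obtain ⟨a, ha⟩ := exists_rotZ_eq v
  obtain ⟨b, hb⟩ := exists_rotZ_eq w
  rcases sq_eq_sq_iff_eq_or_eq_neg.1 h2 with h | h
  · rw [← hrot a v, ← hrot b w, ha, hb, h01, h]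
  · rw [← hrot a v, ← hrot b w, ha, hb, h01, h, ← hrot Real.pi, ← hG.neg_eq]
    congr 1
    apply ext_E3 <;> simp

/-- The squared height is the right parameter: in a tilted plane with highest unit vector h and
horizontal direction e, the squared heights of an orthonormal pair add up to that of h. Here u and v
are such a pair scaled by √(a + b), with squared heights a and b before scaling. -/
theorem IsFrame3.zonal_add (hG : IsFrame3 G W) (hrot : ∀ a v, G (rotZ a v) = G v) {a b : ℝ}
    (ha : 0 ≤ a) (hb : 0 ≤ b) (hab : a + b ≤ 1) :
    G !₂[√(1 - a), 0, √a] + G !₂[√(1 - b), 0, √b] =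
      G !₂[√(1 - (a + b)), 0, √(a + b)] + G !₂[√(1 - 0), 0, √0] := by
  rcases (add_nonneg ha hb).eq_or_lt with h0 | hpos
  · have ha0 : a = 0 := by linarith
    have hb0 : b = 0 := by linarith
    simp [ha0, hb0]
  have hr : √(a + b) ≠ 0 := (Real.sqrt_pos.2 hpos).ne'
  have sa := Real.sq_sqrt ha
  have sb := Real.sq_sqrt hb
  have sr := Real.sq_sqrt hpos.le
  have st := Real.sq_sqrt (sub_nonneg.2 hab)
  have sa' := Real.sq_sqrt (sub_nonneg.2 (show a ≤ 1 by linarith))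
  have sb' := Real.sq_sqrt (sub_nonneg.2 (show b ≤ 1 by linarith))
  set r := √(a + b)
  set t := √(1 - (a + b))
  let n : E3 := !₂[-r, 0, t]
  let h : E3 := !₂[t, 0, r]
  let e : E3 := !₂[0, 1, 0]
  let u : E3 := !₂[√a * t, √b, √a * r]
  let v : E3 := !₂[√b * t, -√a, √b * r]
  have hn : n ≠ 0 := ne_zero_E3_iff.2 (by simp [n, hr])
  have hh : h ≠ 0 := ne_zero_E3_iff.2 (by simp [h, hr])
  have he : e ≠ 0 := ne_zero_E3_iff.2 (by simp [e])
  have hab0 : √a ≠ 0 ∨ √b ≠ 0 := by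
    by_contra hcon
    push Not at hcon
    rw [hcon.1] at sa
    rw [hcon.2] at sb
    linarith
  have hu : u ≠ 0 := ne_zero_E3_iff.2 (by simp only [u]; simp [hr]; tauto)
  have hv : v ≠ 0 := ne_zero_E3_iff.2 (by simp only [v]; simp [hr]; tauto)
  have hp := hG.pair_eq hn hu hv hh he (by simp [n, u, inner_E3]; ring)
    (by simp [n, v, inner_E3]; ring) (by simp [n, h, inner_E3]; ring) (by simp [n, e, inner_E3])
    (by simp [u, v, inner_E3]; linear_combination √a * √b * (sr + st)) (by simp [h, e, inner_E3])
  have e1 : G u = G !₂[√(1 - a), 0, √a] := by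
    rw [← hG.smul_eq (!₂[√(1 - a), 0, √a]) hr]
    apply hG.eq_of_rotZ_invariant hrot
    · simp [u, mul_pow, sa, sb, sr, st, sa']; ring
    · simp [u, mul_pow, sa, sr]; ring
  have e2 : G v = G !₂[√(1 - b), 0, √b] := by
    rw [← hG.smul_eq (!₂[√(1 - b), 0, √b]) hr]
    apply hG.eq_of_rotZ_invariant hrot
    · simp [v, mul_pow, sa, sb, sr, st, sb']; ring
    · simp [v, mul_pow, sb, sr]; ring
  have e3 : G e = G !₂[√(1 - 0), 0, √0] := by
    apply hG.eq_of_rotZ_invariant hrot <;> simp [e]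
  linarith

/-- A bounded frame function that is invariant under the rotations about the vertical axis is an
affine function of the squared height. -/
theorem IsFrame3.zonal_eq (hG : IsFrame3 G W) (hrot : ∀ a v, G (rotZ a v) = G v) {C : ℝ}
    (hC : ∀ v ≠ 0, |G v| ≤ C) {v : E3} (hv : v ≠ 0) :
    G v = (W - G northPole) / 2 + v 2 ^ 2 / ‖v‖ ^ 2 * ((3 * G northPole - W) / 2) := by
  let φ : ℝ → ℝ := fun a => G !₂[√(1 - a), 0, √a]
  have hnv : ‖v‖ ^ 2 = v 0 ^ 2 + v 1 ^ 2 + v 2 ^ 2 := by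
    simp [EuclideanSpace.norm_sq_eq, Fin.sum_univ_three]
  have hnpos : 0 < ‖v‖ ^ 2 := by positivity
  have hc0 : 0 ≤ v 2 ^ 2 / ‖v‖ ^ 2 := by positivity
  have hc1 : v 2 ^ 2 / ‖v‖ ^ 2 ≤ 1 := by
    rw [div_le_one hnpos, hnv]; nlinarith [sq_nonneg (v 0), sq_nonneg (v 1)]
  have hφ : G v = φ (v 2 ^ 2 / ‖v‖ ^ 2) := by
    simp only [φ]
    rw [← hG.smul_eq (!₂[√(1 - v 2 ^ 2 / ‖v‖ ^ 2), 0, √(v 2 ^ 2 / ‖v‖ ^ 2)])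
      (norm_ne_zero_iff.2 hv)]
    apply hG.eq_of_rotZ_invariant hrot
    · simp only [PiLp.smul_apply, smul_eq_mul]
      simp [mul_pow, Real.sq_sqrt (sub_nonneg.2 hc1)]
      field_simp
      rw [hnv]; ring
    · simp only [PiLp.smul_apply, smul_eq_mul]
      simp [mul_pow]
      field_simp
      rw [Real.sq_sqrt (sq_nonneg _)]
  have haff := eq_affine_of_add_eq (φ := φ) (C := C)
    (fun a h0 h1 => hC _ (ne_zero_E3_iff.2 (by
      rcases h0.eq_or_lt with h | h
      · left; simp [← h]
      · right; right; simpa using (Real.sqrt_pos.2 h).ne')))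
    (fun a b ha hb hab => hG.zonal_add hrot ha hb hab) hc0 hc1
  have hφ1 : φ 1 = G northPole := by simp [φ, northPole]
  have hφ0 : φ 0 = (W - G northPole) / 2 := by
    have h := hG !₂[1, 0, 0] !₂[0, 1, 0] northPole (ne_zero_E3_iff.2 (by simp))
      (ne_zero_E3_iff.2 (by simp)) northPole_ne_zero (by simp [inner_E3]) (by simp [inner_E3])
      (by simp [inner_E3])
    have h' : G !₂[0, 1, 0] = G !₂[1, 0, 0] := by
      apply hG.eq_of_rotZ_invariant hrot <;> simp
    simp only [φ, sub_zero, Real.sqrt_one, Real.sqrt_zero]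
    linarith
  rw [hφ, haff, hφ1, hφ0]; ring

end Zonal

/-! ### Averaging over circles of latitude. -/

theorem continuous_rotZ : Continuous fun p : E3 × ℝ => rotZ p.2 p.1 := by
  have : (fun p : E3 × ℝ => rotZ p.2 p.1) = fun p => !₂[Real.cos p.2 * p.1 0 - Real.sin p.2 * p.1 1,
        Real.sin p.2 * p.1 0 + Real.cos p.2 * p.1 1, p.1 2] := by
    funext p; apply ext_E3 <;> simp
  rw [this]
  refine (PiLp.continuous_toLp 2 fun _ : Fin 3 => ℝ).comp (continuous_pi fun i => ?_)
  fin_cases i <;> simp <;> fun_prop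

theorem rotZ_rotZ (a b : ℝ) (v : E3) : rotZ a (rotZ b v) = rotZ (a + b) v := by
  apply ext_E3 <;> simp [Real.cos_add, Real.sin_add] <;> ring

/-- The integral of `F` over the circle of latitude through `v`. -/
noncomputable def circleIntegral3 (F : E3 → ℝ) (v : E3) : ℝ :=
  ∫ θ in (0 : ℝ)..2 * Real.pi, F (rotZ θ v)

section Average

variable {F : E3 → ℝ} {W : ℝ}

theorem continuous_comp_rotZ (hcont : ∀ v ≠ 0, ContinuousAt F v) {v : E3} (hv : v ≠ 0) :
    Continuous fun θ : ℝ => F (rotZ θ v) := by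
  rw [continuous_iff_continuousAt]
  intro θ
  have h1 : ContinuousAt (fun θ : ℝ => rotZ θ v) θ :=
    (continuous_rotZ.comp (Continuous.prodMk_right v)).continuousAt
  have h2 : ContinuousAt F (rotZ θ v) := hcont _ (by simpa using hv)
  exact h2.tendsto.comp h1

theorem IsFrame3.isFrame3_circleIntegral3 (hF : IsFrame3 F W) (hcont : ∀ v ≠ 0, ContinuousAt F v) :
    IsFrame3 (circleIntegral3 F) (2 * Real.pi * W) := by
  intro u v w hu hv hw huv huw hvw
  have iu := (continuous_comp_rotZ hcont hu).intervalIntegrable (μ := volume) 0 (2 * Real.pi)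
  have iv := (continuous_comp_rotZ hcont hv).intervalIntegrable (μ := volume) 0 (2 * Real.pi)
  have iw := (continuous_comp_rotZ hcont hw).intervalIntegrable (μ := volume) 0 (2 * Real.pi)
  unfold circleIntegral3
  rw [← intervalIntegral.integral_add iu iv, ← intervalIntegral.integral_add (iu.add iv) iw]
  have : ∀ θ : ℝ, F (rotZ θ u) + F (rotZ θ v) + F (rotZ θ w) = W := fun θ =>
    hF _ _ _ (by simpa using hu) (by simpa using hv) (by simpa using hw) (by simpa using huv)
      (by simpa using huw) (by simpa using hvw)
  simp [this]

theorem circleIntegral3_rotZ (a : ℝ) (v : E3) :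
    circleIntegral3 F (rotZ a v) = circleIntegral3 F v := by
  unfold circleIntegral3
  simp only [rotZ_rotZ]
  rw [intervalIntegral.integral_comp_add_right (fun θ => F (rotZ θ v))]
  have hper : Function.Periodic (fun θ => F (rotZ θ v)) (2 * Real.pi) := by
    intro θ
    simp only
    congr 1
    apply ext_E3 <;> simp
  have := hper.intervalIntegral_add_eq a 0
  rw [zero_add] at this
  rw [zero_add, add_comm _ a, this]

theorem circleIntegral3_northPole : circleIntegral3 F northPole = 2 * Real.pi * F northPole := by
  have : ∀ θ, rotZ θ northPole = northPole := fun θ => by apply ext_E3 <;> simp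
  simp [circleIntegral3, this]

theorem abs_circleIntegral3_le {C : ℝ} (hC : ∀ v, |F v| ≤ C) (v : E3) :
    |circleIntegral3 F v| ≤ 2 * Real.pi * C := by
  have := intervalIntegral.norm_integral_le_of_norm_le_const (a := 0) (b := 2 * Real.pi) (C := C)
    (f := fun θ => F (rotZ θ v)) (fun θ _ => hC _)
  rw [sub_zero, abs_of_pos Real.two_pi_pos] at this
  rw [mul_comm]
  exact this

theorem integral_ball_comp_isometry (L : E3 ≃ₗᵢ[ℝ] E3) (g : E3 → ℝ) :
    ∫ v in ball (0 : E3) 1, g (L v) = ∫ v in ball (0 : E3) 1, g v := by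
  have h := L.measurePreserving.setIntegral_preimage_emb
    L.toHomeomorph.measurableEmbedding g (ball 0 1)
  rwa [L.preimage_ball, map_zero] at h

theorem integrableOn_ball {g : E3 → ℝ} (hg : Measurable g) {C : ℝ}
    (hC : ∀ v ∈ ball (0 : E3) 1, |g v| ≤ C) : IntegrableOn g (ball (0 : E3) 1) :=
  Measure.integrableOn_of_bounded measure_ball_lt_top.ne hg.aestronglyMeasurable
    (ae_restrict_of_forall_mem measurableSet_ball hC)

theorem abs_apply_le_one {v : E3} (hv : v ∈ ball (0 : E3) 1) (i : Fin 3) : |v i| ≤ 1 :=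
  (PiLp.norm_apply_le v i).trans (by simpa using (mem_ball_zero_iff.1 hv).le)

/-- By Fubini, since each rotation preserves the ball, its measure and the height. -/
theorem integral_ball_mul_circleIntegral3 (hF : Measurable F) {C : ℝ} (hC : ∀ v, |F v| ≤ C) :
    ∫ v in ball (0 : E3) 1, v 2 ^ 2 * circleIntegral3 F v =
      2 * Real.pi * ∫ v in ball (0 : E3) 1, v 2 ^ 2 * F v := by
  have hle := Real.two_pi_pos.le
  have h1 : ∀ v : E3, v 2 ^ 2 * circleIntegral3 F v =
      ∫ θ in Set.Ioc 0 (2 * Real.pi), v 2 ^ 2 * F (rotZ θ v) := fun v => by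
    rw [circleIntegral3, intervalIntegral.integral_of_le hle, integral_const_mul]
  simp only [h1]
  rw [integral_integral_swap]
  · have h2 : ∀ θ : ℝ, ∫ v in ball (0 : E3) 1, v 2 ^ 2 * F (rotZ θ v) =
        ∫ v in ball (0 : E3) 1, v 2 ^ 2 * F v := fun θ =>
      integral_ball_comp_isometry (rotZ θ) fun v => v 2 ^ 2 * F v
    simp [h2, Real.pi_nonneg]
  · rw [Measure.prod_restrict]
    refine Measure.integrableOn_of_bounded (M := C) ?_ ?_ ?_
    · rw [Measure.prod_prod]
      exact ENNReal.mul_ne_top measure_ball_lt_top.ne measure_Ioc_lt_top.ne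
    · have : Measurable fun p : E3 × ℝ => p.1 2 ^ 2 * F (rotZ p.2 p.1) :=
        Measurable.mul (Continuous.measurable (by fun_prop)) (hF.comp continuous_rotZ.measurable)
      exact this.aestronglyMeasurable
    · refine ae_restrict_of_forall_mem (measurableSet_ball.prod measurableSet_Ioc) ?_
      rintro ⟨v, θ⟩ ⟨hv, -⟩
      have h2 : v 2 ^ 2 ≤ 1 := by
        rw [← sq_abs]; exact pow_le_one₀ (abs_nonneg _) (abs_apply_le_one hv 2)
      simp only [Function.uncurry, Real.norm_eq_abs, abs_mul, abs_of_nonneg (sq_nonneg (v 2))]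
      calc v 2 ^ 2 * |F (rotZ θ v)| ≤ 1 * C :=
            mul_le_mul h2 (hC _) (abs_nonneg _) zero_le_one
        _ = C := one_mul C

end Average

/-! ### Integration against the squared inner product. -/

/-- The constant by which integration against the squared inner product multiplies a frame
function of weight zero. -/
noncomputable def frameEigenvalue : ℝ :=
  ∫ v in ball (0 : E3) 1, v 2 ^ 2 * ((3 * (v 2 ^ 2 / ‖v‖ ^ 2) - 1) / 2)

/-- The contribution of the weight to the integral of a frame function against the squared inner
product. -/
noncomputable def frameOffset : ℝ :=
  ∫ v in ball (0 : E3) 1, v 2 ^ 2 * ((1 - v 2 ^ 2 / ‖v‖ ^ 2) / 2)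

theorem norm_sq_E3 (v : E3) : ‖v‖ ^ 2 = v 0 ^ 2 + v 1 ^ 2 + v 2 ^ 2 := by
  simp [EuclideanSpace.norm_sq_eq, Fin.sum_univ_three]

theorem height_div_le_one (v : E3) : v 2 ^ 2 / ‖v‖ ^ 2 ≤ 1 :=
  div_le_one_of_le₀ (by rw [norm_sq_E3]; nlinarith [sq_nonneg (v 0), sq_nonneg (v 1)])
    (by positivity)

theorem sq_apply_le_one {v : E3} (hv : v ∈ ball (0 : E3) 1) (i : Fin 3) : v i ^ 2 ≤ 1 := by
  rw [← sq_abs]; exact pow_le_one₀ (abs_nonneg _) (abs_apply_le_one hv i)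

theorem measurable_apply_E3 (i : Fin 3) : Measurable fun v : E3 => v i :=
  Continuous.measurable (by fun_prop)

theorem abs_mul_le_of_le {a b A B : ℝ} (ha : |a| ≤ A) (hb : |b| ≤ B) : |a * b| ≤ A * B := by
  rw [abs_mul]; exact mul_le_mul ha hb (abs_nonneg _) ((abs_nonneg _).trans ha)

theorem measurable_height : Measurable fun v : E3 => v 2 ^ 2 / ‖v‖ ^ 2 :=
  ((measurable_apply_E3 2).pow_const 2).div (measurable_norm.pow_const 2)

theorem integrableOn_eigenvalue :
    IntegrableOn (fun v : E3 => v 2 ^ 2 * ((3 * (v 2 ^ 2 / ‖v‖ ^ 2) - 1) / 2)) (ball 0 1) := by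
  refine integrableOn_ball (C := 1 * 1) ?_ fun v hv => abs_mul_le_of_le ?_ ?_
  · exact ((measurable_apply_E3 2).pow_const 2).mul
      (((measurable_height.const_mul 3).sub_const 1).div_const 2)
  · rw [abs_of_nonneg (sq_nonneg _)]; exact sq_apply_le_one hv 2
  · have h1 := height_div_le_one v
    have h0 : 0 ≤ v 2 ^ 2 / ‖v‖ ^ 2 := by positivity
    rw [abs_le]; constructor <;> linarith

theorem integrableOn_offset :
    IntegrableOn (fun v : E3 => v 2 ^ 2 * ((1 - v 2 ^ 2 / ‖v‖ ^ 2) / 2)) (ball 0 1) := by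
  refine integrableOn_ball (C := 1 * 1) ?_ fun v hv => abs_mul_le_of_le ?_ ?_
  · exact ((measurable_apply_E3 2).pow_const 2).mul ((measurable_height.const_sub 1).div_const 2)
  · rw [abs_of_nonneg (sq_nonneg _)]; exact sq_apply_le_one hv 2
  · have h1 := height_div_le_one v
    have h0 : 0 ≤ v 2 ^ 2 / ‖v‖ ^ 2 := by positivity
    rw [abs_le]; constructor <;> linarith

theorem integral_inner_sq {s : E3} (hs : ‖s‖ = 1) (F : E3 → ℝ) :
    ∃ L : E3 ≃ₗᵢ[ℝ] E3, L northPole = s ∧ ∫ v in ball (0 : E3) 1, inner ℝ s v ^ 2 * F v =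
      ∫ v in ball (0 : E3) 1, v 2 ^ 2 * F (L v) := by
  obtain ⟨L, hL⟩ := exists_isometry_northPole hs
  refine ⟨L, hL, ?_⟩
  rw [← integral_ball_comp_isometry L]
  have : ∀ v, inner ℝ s (L v) = v 2 := fun v => by
    rw [← hL, L.inner_map_map, inner_E3]; simp
  simp [this]

theorem integral_linear_combination {α : Type*} [MeasurableSpace α] {μ : Measure α}
    {f g h : α → ℝ} (hf : Integrable f μ) (hg : Integrable g μ) (hh : Integrable h μ)
    (a b c : ℝ) : ∫ x, (a * f x + b * g x + c * h x) ∂μ =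
      a * ∫ x, f x ∂μ + b * ∫ x, g x ∂μ + c * ∫ x, h x ∂μ := by
  have hfg : Integrable (fun x => a * f x + b * g x) μ := (hf.const_mul a).add (hg.const_mul b)
  rw [integral_add hfg (hh.const_mul c), integral_add (hf.const_mul a) (hg.const_mul b),
    integral_const_mul, integral_const_mul, integral_const_mul]

/-- The squared coordinates have equal integrals, so (3v₂² - ‖v‖²)/6 integrates to zero. Subtracting
it turns the integrand into (3v₂² - ‖v‖²)²/(6‖v‖²). -/
theorem frameEigenvalue_pos : 0 < frameEigenvalue := by
  have int : ∀ i : Fin 3, IntegrableOn (fun v : E3 => v i ^ 2) (ball 0 1) := fun i =>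
    integrableOn_ball ((measurable_apply_E3 i).pow_const 2) (C := 1) fun v hv => by
      rw [abs_of_nonneg (sq_nonneg _)]; exact sq_apply_le_one hv i
  have eq : ∀ i : Fin 3, ∫ v in ball (0 : E3) 1, v i ^ 2 = ∫ v in ball (0 : E3) 1, v 2 ^ 2 := by
    intro i
    obtain ⟨L, -, h⟩ := integral_inner_sq (s := EuclideanSpace.single i 1) (by simp) fun _ => 1
    simpa [EuclideanSpace.inner_single_left] using h
  let g : E3 → ℝ := fun v => (3 * v 2 ^ 2 - ‖v‖ ^ 2) ^ 2 / ‖v‖ ^ 2 / 6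
  let k : E3 → ℝ := fun v => (-1 / 6) * v 0 ^ 2 + (-1 / 6) * v 1 ^ 2 + (1 / 3) * v 2 ^ 2
  have hk : IntegrableOn k (ball 0 1) :=
    (((int 0).const_mul _).add ((int 1).const_mul _)).add ((int 2).const_mul _)
  have hk0 : ∫ v in ball (0 : E3) 1, k v = 0 := by
    simp only [k]
    rw [integral_linear_combination (int 0) (int 1) (int 2), eq 0, eq 1]
    ring
  have hg : ∀ v, v 2 ^ 2 * ((3 * (v 2 ^ 2 / ‖v‖ ^ 2) - 1) / 2) - k v = g v := by
    intro v
    by_cases hv : v = 0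
    · simp [hv, k, g]
    have hv : ‖v‖ ≠ 0 := norm_ne_zero_iff.2 hv
    have hk' : k v = (3 * v 2 ^ 2 - ‖v‖ ^ 2) / 6 := by simp only [k, norm_sq_E3]; ring
    rw [hk']
    simp only [g]
    field_simp
    ring
  have hgi : IntegrableOn g (ball 0 1) := by
    have := integrableOn_eigenvalue.sub hk
    exact this.congr (Eventually.of_forall hg)
  have hint : frameEigenvalue = ∫ v in ball (0 : E3) 1, g v := by
    rw [← sub_zero frameEigenvalue, ← hk0, frameEigenvalue, ← integral_sub
      integrableOn_eigenvalue hk]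
    simp only [hg]
  rw [hint, setIntegral_pos_iff_support_of_nonneg_ae
    (Eventually.of_forall fun v => by simp only [g, Pi.zero_apply]; positivity) hgi]
  let U : Set E3 := {v | 3 * v 2 ^ 2 - ‖v‖ ^ 2 ≠ 0}
  have hU : IsOpen U := isOpen_ne_fun (by fun_prop) (by fun_prop)
  have hne : (U ∩ ball 0 1).Nonempty := by
    refine ⟨(1 / 2 : ℝ) • northPole, ?_, ?_⟩
    · simp only [U, Set.mem_ofPred_eq, norm_smul, norm_northPole]
      norm_num
    · rw [mem_ball_zero_iff, norm_smul, norm_northPole]; norm_num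
  refine ((hU.inter isOpen_ball).measure_pos volume hne).trans_le (measure_mono ?_)
  rintro v ⟨hv, hvb⟩
  refine ⟨?_, hvb⟩
  have hv0 : ‖v‖ ≠ 0 := by
    intro h0
    rw [norm_eq_zero] at h0
    exact hv (by simp [h0])
  simp only [Function.mem_support, g]
  have hv' : 3 * v 2 ^ 2 - ‖v‖ ^ 2 ≠ 0 := hv
  positivity

/-! ### Gleason's theorem on three-space. -/

section

variable {F : E3 → ℝ} {W m : ℝ}

theorem IsFrame3.measurable (hF : IsFrame3 F W) (hm : ∀ v ≠ 0, m ≤ F v) : Measurable F :=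
  measurable_of_continuousOn_compl_singleton 0 fun _ hv =>
    (hF.continuousAt hm hv).continuousWithinAt

theorem IsFrame3.exists_abs_le (hF : IsFrame3 F W) (hm : ∀ v ≠ 0, m ≤ F v) :
    ∃ C, ∀ v, |F v| ≤ C := by
  refine ⟨|F 0| + (|m| + |W - 2 * m|), fun v => ?_⟩
  have h1 := abs_nonneg (F 0)
  have h2 := neg_abs_le m
  have h3 := le_abs_self (W - 2 * m)
  have h4 := abs_nonneg m
  have h5 := abs_nonneg (W - 2 * m)
  by_cases hv : v = 0
  · rw [hv]; linarith
  rw [abs_le]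
  constructor <;> linarith [hm v hv, hF.le_of_le hm hv]

/-- The average of F about the axis gives the same integral up to the factor 2π, and it is an
explicit zonal function. -/
theorem IsFrame3.integral_northPole (hF : IsFrame3 F W) (hm : ∀ v ≠ 0, m ≤ F v) :
    ∫ v in ball (0 : E3) 1, v 2 ^ 2 * F v =
      F northPole * frameEigenvalue + W * frameOffset := by
  obtain ⟨C, hC⟩ := hF.exists_abs_le hm
  have hcont : ∀ v ≠ 0, ContinuousAt F v := fun v hv => hF.continuousAt hm hv
  have h1 := integral_ball_mul_circleIntegral3 (hF.measurable hm) hC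
  have h2 : ∀ v : E3, v 2 ^ 2 * circleIntegral3 F v = 2 * Real.pi *
      (F northPole * (v 2 ^ 2 * ((3 * (v 2 ^ 2 / ‖v‖ ^ 2) - 1) / 2)) +
        W * (v 2 ^ 2 * ((1 - v 2 ^ 2 / ‖v‖ ^ 2) / 2))) := by
    intro v
    by_cases hv : v = 0
    · simp [hv]
    rw [(hF.isFrame3_circleIntegral3 hcont).zonal_eq circleIntegral3_rotZ
      (fun v _ => abs_circleIntegral3_le hC v) hv, circleIntegral3_northPole]
    ring
  simp only [h2] at h1
  rw [integral_const_mul] at h1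
  rw [← mul_left_cancel₀ Real.two_pi_pos.ne' h1, integral_add
    (integrableOn_eigenvalue.const_mul _) (integrableOn_offset.const_mul _), integral_const_mul,
    integral_const_mul, frameEigenvalue, frameOffset]

/-- The formula at the pole, rotated to x and solved for F x. On the right x enters only through a
squared inner product and ‖x‖², so the expression is quadratic in x. -/
theorem IsFrame3.norm_sq_mul_eq (hF : IsFrame3 F W) (hm : ∀ v ≠ 0, m ≤ F v) (x : E3) :
    ‖x‖ ^ 2 * F x = ((∫ v in ball (0 : E3) 1, inner ℝ x v ^ 2 * F v) -
      W * frameOffset * ‖x‖ ^ 2) / frameEigenvalue := by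
  by_cases hx : x = 0
  · simp [hx]
  have hx0 : ‖x‖ ≠ 0 := norm_ne_zero_iff.2 hx
  obtain ⟨L, hL, h⟩ := integral_inner_sq (s := ‖x‖⁻¹ • x) (by simp [norm_smul, hx0]) F
  have h2 := (hF.comp_isometry L).integral_northPole (m := m)
    fun v hv => hm _ (by simpa using hv)
  simp only [Function.comp, hL, hF.smul_eq x (inv_ne_zero hx0)] at h2
  rw [← h] at h2
  simp only [inner_smul_left, mul_pow, mul_assoc] at h2
  rw [integral_const_mul] at h2
  simp only [RCLike.conj_to_real, inv_pow] at h2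
  rw [inv_mul_eq_iff_eq_mul₀ (pow_ne_zero 2 hx0)] at h2
  rw [h2, eq_div_iff frameEigenvalue_pos.ne']
  ring

/-- Gleason's theorem for three-space: a frame function that is bounded below is the restriction
of a quadratic form. -/
theorem IsFrame3.exists_polar (hF : IsFrame3 F W) (hm : ∀ v ≠ 0, m ≤ F v) (u v : E3) :
    ∃ k : ℝ, ∀ a b : ℝ, ‖a • u + b • v‖ ^ 2 * F (a • u + b • v) =
      a ^ 2 * (‖u‖ ^ 2 * F u) + b ^ 2 * (‖v‖ ^ 2 * F v) + a * b * k := by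
  obtain ⟨C, hC⟩ := hF.exists_abs_le hm
  have int : ∀ x y : E3, IntegrableOn (fun v => inner ℝ x v * inner ℝ y v * F v) (ball 0 1) := by
    intro x y
    refine integrableOn_ball (C := ‖x‖ * ‖y‖ * C) ?_ fun v hv => ?_
    · exact (Continuous.measurable (by fun_prop)).mul (hF.measurable hm)
    · have hv1 : ‖v‖ ≤ 1 := (mem_ball_zero_iff.1 hv).le
      have hi : ∀ x : E3, |inner ℝ x v| ≤ ‖x‖ := fun x =>
        (abs_real_inner_le_norm x v).trans (mul_le_of_le_one_right (norm_nonneg _) hv1)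
      exact abs_mul_le_of_le (abs_mul_le_of_le (hi x) (hi y)) (hC v)
  refine ⟨2 * ((∫ x in ball (0 : E3) 1, inner ℝ u x * inner ℝ v x * F x) -
    W * frameOffset * inner ℝ u v) / frameEigenvalue, fun a b => ?_⟩
  rw [hF.norm_sq_mul_eq hm, hF.norm_sq_mul_eq hm u, hF.norm_sq_mul_eq hm v]
  have e1 : ∀ x : E3, inner ℝ (a • u + b • v) x ^ 2 * F x =
      a ^ 2 * (inner ℝ u x * inner ℝ u x * F x) + b ^ 2 * (inner ℝ v x * inner ℝ v x * F x) +
        2 * a * b * (inner ℝ u x * inner ℝ v x * F x) := by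
    intro x
    simp only [inner_add_left, inner_smul_left, RCLike.conj_to_real]
    ring
  have e2 : ‖a • u + b • v‖ ^ 2 = a ^ 2 * ‖u‖ ^ 2 + b ^ 2 * ‖v‖ ^ 2 + 2 * a * b * inner ℝ u v := by
    rw [norm_add_sq_real, norm_smul, norm_smul, inner_smul_left, inner_smul_right, mul_pow,
      mul_pow, Real.norm_eq_abs, Real.norm_eq_abs, sq_abs, sq_abs, RCLike.conj_to_real]
    ring
  simp only [e1]
  rw [integral_linear_combination (int u u) (int v v) (int u v), e2]
  simp only [← pow_two]
  ring

end

/-! ### From real quadraticity to Hermitian forms. -/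

open scoped ComplexConjugate

section PhaseQuadratic

variable {𝕜 E : Type*} [RCLike 𝕜] [NormedAddCommGroup E] [InnerProductSpace 𝕜 E]

/-- A function that scales like a Hermitian form and is quadratic on the real span of every
orthogonal pair. -/
structure IsPhaseQuadratic (h : E → 𝕜) : Prop where
  smul : ∀ (c : 𝕜) x, h (c • x) = c * conj c * h x
  polar : ∀ u v : E, inner 𝕜 u v = 0 → ∃ k : 𝕜, ∀ a b : ℝ,
    h ((a : 𝕜) • u + (b : 𝕜) • v) = a ^ 2 * h u + b ^ 2 * h v + a * b * k

/-- On the span of `x` and `y` the function `N` is a Hermitian form. -/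
def IsHermitianOnPair (N : E → ℝ) (x y : E) : Prop :=
  ∃ c : 𝕜, ∀ a b : 𝕜, (N (a • x + b • y) : 𝕜) =
    a * conj a * N x + b * conj b * N y + a * conj b * c + conj a * b * conj c

theorem IsPhaseQuadratic.sub {h k : E → 𝕜} (hh : IsPhaseQuadratic h) (hk : IsPhaseQuadratic k) :
    IsPhaseQuadratic fun x => h x - k x where
  smul c x := by rw [hh.smul, hk.smul]; ring
  polar u v huv := by
    obtain ⟨a, ha⟩ := hh.polar u v huv
    obtain ⟨b, hb⟩ := hk.polar u v huv
    exact ⟨a - b, fun s t => by rw [ha, hb]; ring⟩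

theorem isPhaseQuadratic_form (e₁ e₂ : E) (p q c : 𝕜) :
    IsPhaseQuadratic fun x : E =>
      inner 𝕜 e₁ x * conj (inner 𝕜 e₁ x) * p + inner 𝕜 e₂ x * conj (inner 𝕜 e₂ x) * q +
        inner 𝕜 e₁ x * conj (inner 𝕜 e₂ x) * c +
          conj (inner 𝕜 e₁ x) * inner 𝕜 e₂ x * conj c where
  smul a x := by simp only [inner_smul_right, map_mul]; ring
  polar u v _ := by
    generalize hu1 : inner 𝕜 e₁ u = u1
    generalize hu2 : inner 𝕜 e₂ u = u2
    generalize hv1 : inner 𝕜 e₁ v = v1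
    generalize hv2 : inner 𝕜 e₂ v = v2
    refine ⟨(u1 * conj v1 + v1 * conj u1) * p + (u2 * conj v2 + v2 * conj u2) * q +
      (u1 * conj v2 + v1 * conj u2) * c + (conj u1 * v2 + conj v1 * u2) * conj c, fun a b => ?_⟩
    simp only [inner_add_right, inner_smul_right, map_add, map_mul, RCLike.conj_ofReal, hu1, hu2,
      hv1, hv2]
    ring

namespace IsPhaseQuadratic

variable {h : E → 𝕜}

theorem zero_add_of_zero (hh : IsPhaseQuadratic h) {u v : E} (huv : inner 𝕜 u v = 0) (hu : h u = 0)
    (hv : h v = 0) (hs : h (u + v) = 0) (a b : ℝ) : h ((a : 𝕜) • u + (b : 𝕜) • v) = 0 := by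
  obtain ⟨k, hk⟩ := hh.polar u v huv
  have h1 := hk 1 1
  simp only [RCLike.ofReal_one, one_smul, hs, hu, hv] at h1
  have hk0 : k = 0 := by linear_combination -h1
  rw [hk, hu, hv, hk0]
  ring

/-- Three zeros kill h on the real span of e₁, e₂. In the complex case f± = e₁ ± I e₂ is again an
orthogonal pair of zeros. For |l| = 1 the vector l f₊ + f₋ is a scalar multiple of a real
combination of e₁ and e₂, hence a zero, so h vanishes on the real span of l f₊ and f₋. Every vector
is a scalar multiple of one in such a span. -/
theorem eq_zero (hh : IsPhaseQuadratic h) {e₁ e₂ : E} (h1 : ‖e₁‖ = 1) (h2 : ‖e₂‖ = 1)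
    (h12 : inner 𝕜 e₁ e₂ = 0) (he₁ : h e₁ = 0) (he₂ : h e₂ = 0) (hs : h (e₁ + e₂) = 0)
    (hI : h (e₁ + (RCLike.I : 𝕜) • e₂) = 0) (a b : 𝕜) : h (a • e₁ + b • e₂) = 0 := by
  have hreal := hh.zero_add_of_zero h12 he₁ he₂ hs
  rcases (RCLike.I_mul_I : (RCLike.I : 𝕜) = 0 ∨ (RCLike.I : 𝕜) * RCLike.I = -1) with hI0 | hII
  · have : ∀ z : 𝕜, ((RCLike.re z : ℝ) : 𝕜) = z := fun z => by
      conv_rhs => rw [← RCLike.re_add_im z, hI0, mul_zero, add_zero]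
    rw [← this a, ← this b]
    exact hreal _ _
  set I : 𝕜 := RCLike.I with hIdef
  have hIc : conj I = -I := RCLike.conj_I
  have h21 : inner 𝕜 e₂ e₁ = 0 := inner_eq_zero_symm.1 h12
  have h11 : inner 𝕜 e₁ e₁ = (1 : 𝕜) := by rw [inner_self_eq_norm_sq_to_K, h1]; simp
  have h22 : inner 𝕜 e₂ e₂ = (1 : 𝕜) := by rw [inner_self_eq_norm_sq_to_K, h2]; simp
  have hu₂ : h (e₁ - I • e₂) = 0 := by
    have := hh.zero_add_of_zero (v := I • e₂) (by rw [inner_smul_right, h12, mul_zero]) he₁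
      (by rw [hh.smul, he₂, mul_zero]) hI 1 (-1)
    simpa [sub_eq_add_neg] using this
  have horth : inner 𝕜 (e₁ + I • e₂) (e₁ - I • e₂) = 0 := by
    simp only [inner_add_left, inner_sub_right, inner_smul_left, inner_smul_right, h11, h12, h21,
      h22, hIc]
    linear_combination hII
  have hunit : ∀ l : 𝕜, l * conj l = 1 → h (l • (e₁ + I • e₂) + (e₁ - I • e₂)) = 0 := by
    intro l hl
    by_cases hl1 : l + 1 = 0
    · have : l • (e₁ + I • e₂) + (e₁ - I • e₂) = (-2 * I) • e₂ := by
        rw [eq_neg_of_add_eq_zero_left hl1]; module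
      rw [this, hh.smul, he₂, mul_zero]
    · have hl0 : l ≠ 0 := by rintro rfl; simp at hl
      have hlc : conj l = l⁻¹ := eq_inv_of_mul_eq_one_right hl
      -- The Cayley transform maps the unit circle without -1 to the real line; this is the ratio of
      -- the coefficients of e₂ and e₁ in l f₊ + f₋.
      have hw : conj (I * (l - 1) / (l + 1)) = I * (l - 1) / (l + 1) := by
        have hl1' : 1 + l ≠ 0 := by rwa [add_comm]
        simp only [map_div₀, map_mul, map_sub, map_add, map_one, hIc, hlc]
        field_simp
        ring
      obtain ⟨r, hr⟩ := RCLike.conj_eq_iff_real.1 hw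
      have : l • (e₁ + I • e₂) + (e₁ - I • e₂) =
          (l + 1) • (((1 : ℝ) : 𝕜) • e₁ + (r : 𝕜) • e₂) := by
        have hm : (l + 1) * (r : 𝕜) = I * (l - 1) := by rw [← hr, mul_div_cancel₀ _ hl1]
        have : (l + 1) • (((1 : ℝ) : 𝕜) • e₁ + (r : 𝕜) • e₂) =
            (l + 1) • e₁ + ((l + 1) * (r : 𝕜)) • e₂ := by
          rw [RCLike.ofReal_one]; module
        rw [this, hm]
        module
      rw [this, hh.smul, hreal, mul_zero]
  set c₁ := (a - I * b) / 2 with hc₁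
  set c₂ := (a + I * b) / 2 with hc₂
  have hdecomp : a • e₁ + b • e₂ = c₁ • (e₁ + I • e₂) + c₂ • (e₁ - I • e₂) := by
    have ha : a = c₁ + c₂ := by rw [hc₁, hc₂]; ring
    have hb : b = I * c₁ - I * c₂ := by
      rw [hc₁, hc₂]; linear_combination b * hII
    rw [hb]
    nth_rewrite 1 [ha]
    module
  rw [hdecomp]
  by_cases hc : c₂ = 0
  · rw [hc, zero_smul, add_zero, hh.smul, hI, mul_zero]
  by_cases hc' : c₁ = 0
  · rw [hc', zero_smul, zero_add, hh.smul, hu₂, mul_zero]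
  set d := c₁ / c₂ with hd
  have hd0 : d ≠ 0 := div_ne_zero hc' hc
  have hdn : (‖d‖ : 𝕜) ≠ 0 := by simpa using hd0
  have hl : (d / ‖d‖) * conj (d / (‖d‖ : 𝕜)) = 1 := by
    rw [RCLike.mul_conj, norm_div, RCLike.norm_ofReal, abs_norm, div_self (norm_ne_zero_iff.2 hd0)]
    simp
  have hfin := hh.zero_add_of_zero (u := (d / (‖d‖ : 𝕜)) • (e₁ + I • e₂)) (v := e₁ - I • e₂)
    (by rw [inner_smul_left, horth, mul_zero]) (by rw [hh.smul, hI, mul_zero]) hu₂ (hunit _ hl)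
    ‖d‖ 1
  have : c₁ • (e₁ + I • e₂) + c₂ • (e₁ - I • e₂) =
      c₂ • ((‖d‖ : 𝕜) • (d / (‖d‖ : 𝕜)) • (e₁ + I • e₂) + ((1 : ℝ) : 𝕜) • (e₁ - I • e₂)) := by
    have h3 : (‖d‖ : 𝕜) * (d / (‖d‖ : 𝕜)) = d := mul_div_cancel₀ _ hdn
    have h4 : c₂ * d = c₁ := mul_div_cancel₀ _ hc
    rw [smul_smul (‖d‖ : 𝕜), h3, RCLike.ofReal_one, one_smul, ← h4]
    module
  rw [this, hh.smul, hfin, mul_zero]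

variable {N : E → ℝ}

/-- The values at e₁ + e₂ and e₁ + I e₂ determine the real and imaginary parts of the off-diagonal
entry. The difference from the resulting Hermitian form satisfies the hypotheses of `eq_zero`. -/
theorem isHermitianOnPair_of_orthonormal (hN : IsPhaseQuadratic fun x => (N x : 𝕜)) {e₁ e₂ : E}
    (h1 : ‖e₁‖ = 1) (h2 : ‖e₂‖ = 1) (h12 : inner 𝕜 e₁ e₂ = 0) :
    IsHermitianOnPair (𝕜 := 𝕜) N e₁ e₂ := by
  have h21 : inner 𝕜 e₂ e₁ = 0 := inner_eq_zero_symm.1 h12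
  have h11 : inner 𝕜 e₁ e₁ = (1 : 𝕜) := by rw [inner_self_eq_norm_sq_to_K, h1]; simp
  have h22 : inner 𝕜 e₂ e₂ = (1 : 𝕜) := by rw [inner_self_eq_norm_sq_to_K, h2]; simp
  set I : 𝕜 := RCLike.I with hIdef
  have hIc : conj I = -I := RCLike.conj_I
  let p : ℝ := (N (e₁ + e₂) - N e₁ - N e₂) / 2
  let q : ℝ := (N (e₁ + I • e₂) - N e₁ - N e₂) / 2
  have hp : (p : 𝕜) = ((N (e₁ + e₂) : 𝕜) - N e₁ - N e₂) / 2 := by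
    simp only [p, RCLike.ofReal_div, RCLike.ofReal_sub, RCLike.ofReal_ofNat]
  have hq : (q : 𝕜) = ((N (e₁ + I • e₂) : 𝕜) - N e₁ - N e₂) / 2 := by
    simp only [q, RCLike.ofReal_div, RCLike.ofReal_sub, RCLike.ofReal_ofNat]
  have hh := hN.sub (isPhaseQuadratic_form e₁ e₂ (N e₁ : 𝕜) (N e₂ : 𝕜) (p + q * I))
  have hzero := hh.eq_zero h1 h2 h12 (by simp [h1, h21]) (by simp [h2, h12])
    (by
      simp only [inner_add_right, h11, h12, h21, h22, map_add, map_mul, map_one, map_zero,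
        RCLike.conj_ofReal, hIc]
      linear_combination (-2 : 𝕜) * hp)
    (by
      simp only [← hIdef, inner_add_right, inner_smul_right, h11, h12, h21, h22, map_add, map_mul,
        map_one, map_zero, RCLike.conj_ofReal, hIc]
      rcases (RCLike.I_mul_I : (RCLike.I : 𝕜) = 0 ∨ (RCLike.I : 𝕜) * RCLike.I = -1) with h | h
      · rw [← hIdef] at h
        rw [h]
        simp
      · rw [← hIdef] at h
        linear_combination (-2 : 𝕜) * hq + ((N e₂ : 𝕜) + 2 * q) * h)
  refine ⟨p + q * I, fun a b => ?_⟩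
  have := hzero a b
  simp only [inner_add_right, inner_smul_right, h11, h12, h21, h22, mul_one, mul_zero, add_zero,
    zero_add] at this
  linear_combination this

end IsPhaseQuadratic

theorem IsHermitianOnPair.of_span {N : E → ℝ} {u v : E} (h : IsHermitianOnPair (𝕜 := 𝕜) N u v)
    (p q r s : 𝕜) : IsHermitianOnPair (𝕜 := 𝕜) N (p • u + q • v) (r • u + s • v) := by
  obtain ⟨c, hc⟩ := h
  refine ⟨p * conj r * N u + q * conj s * N v + p * conj s * c + q * conj r * conj c,
    fun a b => ?_⟩
  have : a • (p • u + q • v) + b • (r • u + s • v) = (a * p + b * r) • u + (a * q + b * s) • v := by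
    module
  rw [this, hc, hc, hc]
  simp only [map_add, map_mul, RCLike.conj_ofReal, RCLike.conj_conj]
  ring

/-- Gram–Schmidt reduces an arbitrary pair to an orthonormal one; dependent pairs follow from
scaling alone. -/
theorem IsPhaseQuadratic.isHermitianOnPair {N : E → ℝ} (hN : IsPhaseQuadratic fun x => (N x : 𝕜))
    (x y : E) : IsHermitianOnPair (𝕜 := 𝕜) N x y := by
  by_cases hx : x = 0
  · refine ⟨0, fun a b => ?_⟩
    have h0 := hN.smul 0 (0 : E)
    have h1 := hN.smul b y
    simp only [zero_smul, zero_mul] at h0 h1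
    simp [hx, h0, h1]
  have hx0 : (‖x‖ : 𝕜) ≠ 0 := by simpa using hx
  obtain ⟨e₁, he₁⟩ : ∃ e : E, e = (‖x‖ : 𝕜)⁻¹ • x := ⟨_, rfl⟩
  have h1 : ‖e₁‖ = 1 := by simp [he₁, norm_smul, hx]
  have h11 : inner 𝕜 e₁ e₁ = (1 : 𝕜) := by rw [inner_self_eq_norm_sq_to_K, h1]; simp
  have hxe : x = (‖x‖ : 𝕜) • e₁ := by rw [he₁, smul_smul, mul_inv_cancel₀ hx0, one_smul]
  set z := y - inner 𝕜 e₁ y • e₁ with hz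
  have hez : inner 𝕜 e₁ z = 0 := by
    rw [hz, inner_sub_right, inner_smul_right, h11, mul_one, sub_self]
  by_cases hz0 : z = 0
  · have hy : y = inner 𝕜 e₁ y • e₁ := sub_eq_zero.1 (hz ▸ hz0)
    generalize inner 𝕜 e₁ y = d at hy
    refine ⟨(‖x‖ : 𝕜) * conj d * N e₁, fun a b => ?_⟩
    have hs : ∀ c : 𝕜, (N (c • e₁) : 𝕜) = c * conj c * N e₁ := fun c => hN.smul c e₁
    generalize ‖x‖ = r at hxe
    rw [hxe, hy, smul_smul, smul_smul, ← add_smul, hs, hs, hs]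
    simp only [map_add, map_mul, RCLike.conj_ofReal, RCLike.conj_conj]
    ring
  have hzn : (‖z‖ : 𝕜) ≠ 0 := by simpa using hz0
  obtain ⟨e₂, he₂⟩ : ∃ e : E, e = (‖z‖ : 𝕜)⁻¹ • z := ⟨_, rfl⟩
  have h2 : ‖e₂‖ = 1 := by simp [he₂, norm_smul, hz0]
  have h := (hN.isHermitianOnPair_of_orthonormal h1 h2
    (by rw [he₂, inner_smul_right, hez, mul_zero])).of_span (‖x‖ : 𝕜) 0 (inner 𝕜 e₁ y) (‖z‖ : 𝕜)
  have hze : (‖z‖ : 𝕜) • e₂ = z := by rw [he₂, smul_smul, mul_inv_cancel₀ hzn, one_smul]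
  rwa [hze, zero_smul, add_zero, ← hxe, hz, add_sub_cancel] at h

/-! ### Polarization and its sesquilinearity. -/

/-- The polarization of `N`. -/
noncomputable def polarization (𝕜 : Type*) [RCLike 𝕜] [Module 𝕜 E] (N : E → ℝ) (x y : E) : 𝕜 :=
  (((N (x + y) - N (x - y)) / 4 : ℝ) : 𝕜) +
    (((N (x + (RCLike.I : 𝕜) • y) - N (x - (RCLike.I : 𝕜) • y)) / 4 : ℝ) : 𝕜) * RCLike.I

/-- The mixed coefficient is thereby unique, so identities for the polarization follow by exhibiting
a coefficient that works. -/
theorem polarization_eq {N : E → ℝ} {x y : E} {c : 𝕜} (hc : ∀ a b : 𝕜, (N (a • x + b • y) : 𝕜) =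
    a * conj a * N x + b * conj b * N y + a * conj b * c + conj a * b * conj c) :
    polarization 𝕜 N x y = c := by
  have key : ∀ b : 𝕜, (N (x + b • y) - N (x - b • y)) / 4 = RCLike.re (conj b * c) := by
    intro b
    have h1 := hc 1 b
    have h2 := hc 1 (-b)
    rw [one_smul, neg_smul, ← sub_eq_add_neg] at h2
    rw [one_smul] at h1
    have h3 := RCLike.add_conj (conj b * c)
    have h4 : (((N (x + b • y) - N (x - b • y)) / 4 : ℝ) : 𝕜) =
        (RCLike.re (conj b * c) : ℝ) := by
      simp only [map_mul, RCLike.conj_conj] at h3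
      simp only [RCLike.ofReal_div, RCLike.ofReal_sub, RCLike.ofReal_ofNat]
      rw [h1, h2]
      simp only [map_one, map_neg]
      linear_combination (1 / 2 : 𝕜) * h3
    exact_mod_cast h4
  have k1 := key 1
  have k2 := key RCLike.I
  rw [one_smul, map_one, one_mul] at k1
  rw [RCLike.conj_I, neg_mul, map_neg, RCLike.I_mul_re, neg_neg] at k2
  rw [polarization, k1, k2, RCLike.re_add_im]

namespace IsPhaseQuadratic

variable {N : E → ℝ}

theorem apply_eq (hN : IsPhaseQuadratic fun x => (N x : 𝕜)) (x y : E) (a b : 𝕜) :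
    (N (a • x + b • y) : 𝕜) =
    a * conj a * N x + b * conj b * N y + a * conj b * polarization 𝕜 N x y +
      conj a * b * conj (polarization 𝕜 N x y) := by
  obtain ⟨c, hc⟩ := hN.isHermitianOnPair x y
  rw [polarization_eq hc]
  exact hc a b

theorem polarization_self (hN : IsPhaseQuadratic fun x => (N x : 𝕜)) (x : E) :
    polarization 𝕜 N x x = N x := by
  refine polarization_eq fun a b => ?_
  have h := hN.smul (a + b) x
  simp only [add_smul, map_add, RCLike.conj_ofReal] at h ⊢
  rw [h]; ring

theorem polarization_symm (hN : IsPhaseQuadratic fun x => (N x : 𝕜)) (x y : E) :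
    polarization 𝕜 N x y = conj (polarization 𝕜 N y x) := by
  refine polarization_eq fun a b => ?_
  rw [add_comm, hN.apply_eq y x b a, RCLike.conj_conj]
  ring

theorem polarization_smul (hN : IsPhaseQuadratic fun x => (N x : 𝕜)) (c : 𝕜) (x y : E) :
    polarization 𝕜 N (c • x) y = c * polarization 𝕜 N x y := by
  refine polarization_eq fun a b => ?_
  have h := hN.smul c x
  rw [smul_smul, hN.apply_eq x y, h, map_mul, map_mul]
  ring

theorem parallelogram (hN : IsPhaseQuadratic fun x => (N x : 𝕜)) (x y : E) :
    N (x + y) + N (x - y) = 2 * N x + 2 * N y := by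
  have h1 := hN.apply_eq x y 1 1
  have h2 := hN.apply_eq x y 1 (-1)
  rw [neg_smul, one_smul, one_smul, ← sub_eq_add_neg] at h2
  rw [one_smul, one_smul] at h1
  have : ((N (x + y) + N (x - y) : ℝ) : 𝕜) = ((2 * N x + 2 * N y : ℝ) : 𝕜) := by
    simp only [RCLike.ofReal_add, RCLike.ofReal_mul, RCLike.ofReal_ofNat]
    rw [h1, h2]
    simp only [map_one, map_neg]
    ring
  exact_mod_cast this

/-- Information on pairs says nothing directly about three vectors; additivity comes from the
parallelogram law, as in the Jordan–von Neumann theorem. -/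
theorem polarization_add (hN : IsPhaseQuadratic fun x => (N x : 𝕜)) (x y z : E) :
    polarization 𝕜 N (x + y) z = polarization 𝕜 N x z + polarization 𝕜 N y z := by
  have hneg : ∀ w : E, N (-w) = N w := fun w => by
    have h := hN.smul (-1) w
    rw [neg_smul, one_smul] at h
    have h' : (N (-w) : 𝕜) = N w := by rw [h]; simp
    exact_mod_cast h'
  have mid : ∀ x y w : E, (N (x + y + w) - N (x + y - w)) + (N (x - y + w) - N (x - y - w)) =
      2 * (N (x + w) - N (x - w)) := fun x y w => by
    have h1 := hN.parallelogram (x + w) y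
    have h2 := hN.parallelogram (x - w) y
    rw [show x + w + y = x + y + w by abel, show x + w - y = x - y + w by abel] at h1
    rw [show x - w + y = x + y - w by abel, show x - w - y = x - y - w by abel] at h2
    linarith
  have dbl : ∀ x w : E, N (x + x + w) - N (x + x - w) = 2 * (N (x + w) - N (x - w)) :=
    fun x w => by
      have h := mid x x w
      rw [sub_self, zero_add, zero_sub, hneg, sub_self, add_zero] at h
      exact h
  have add : ∀ w : E, N (x + y + w) - N (x + y - w) =
      (N (x + w) - N (x - w)) + (N (y + w) - N (y - w)) := fun w => by
    have h := mid ((2⁻¹ : 𝕜) • (x + y)) ((2⁻¹ : 𝕜) • (x - y)) w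
    have e1 : (2⁻¹ : 𝕜) • (x + y) + (2⁻¹ : 𝕜) • (x - y) = x := by module
    have e2 : (2⁻¹ : 𝕜) • (x + y) - (2⁻¹ : 𝕜) • (x - y) = y := by module
    have e3 : (2⁻¹ : 𝕜) • (x + y) + (2⁻¹ : 𝕜) • (x + y) = x + y := by module
    rw [e1, e2, ← dbl, e3] at h
    linarith
  simp only [polarization, add]
  push_cast
  ring

end IsPhaseQuadratic

end PhaseQuadratic

/-! ### Restricting a frame type function to three-space. -/

section FrameToForm

variable {𝕜 E : Type*} [RCLike 𝕜] [NormedAddCommGroup E] [InnerProductSpace 𝕜 E]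

/-- The real-linear embedding of three-space given by an orthonormal triple. -/
def tripleEmbedding (e : Fin 3 → E) (a : E3) : E :=
  (a 0 : 𝕜) • e 0 + (a 1 : 𝕜) • e 1 + (a 2 : 𝕜) • e 2

theorem inner_tripleEmbedding {e : Fin 3 → E} (he : Orthonormal 𝕜 e) (a b : E3) :
    inner 𝕜 (tripleEmbedding (𝕜 := 𝕜) e a) (tripleEmbedding (𝕜 := 𝕜) e b) =
      ((inner ℝ a b : ℝ) : 𝕜) := by
  have h := orthonormal_iff_ite.1 he
  simp only [tripleEmbedding, inner_add_left, inner_add_right, inner_smul_left, inner_smul_right,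
    h, inner_E3, RCLike.conj_ofReal]
  simp
  ring

theorem norm_tripleEmbedding {e : Fin 3 → E} (he : Orthonormal 𝕜 e) (a : E3) :
    ‖tripleEmbedding (𝕜 := 𝕜) e a‖ = ‖a‖ := by
  have h := inner_tripleEmbedding he a a
  rw [inner_self_eq_norm_sq_to_K, real_inner_self_eq_norm_sq] at h
  have h' : ‖tripleEmbedding (𝕜 := 𝕜) e a‖ ^ 2 = ‖a‖ ^ 2 := by exact_mod_cast h
  exact (sq_eq_sq₀ (norm_nonneg _) (norm_nonneg _)).1 h'

theorem tripleEmbedding_ne_zero {e : Fin 3 → E} (he : Orthonormal 𝕜 e) {a : E3} (ha : a ≠ 0) :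
    tripleEmbedding (𝕜 := 𝕜) e a ≠ 0 := by
  rwa [← norm_ne_zero_iff, norm_tripleEmbedding he, norm_ne_zero_iff]

theorem tripleEmbedding_mem_span (e : Fin 3 → E) (a : E3) :
    tripleEmbedding (𝕜 := 𝕜) e a ∈ Submodule.span 𝕜 (Set.range e) := by
  have h : ∀ i, e i ∈ Submodule.span 𝕜 (Set.range e) := fun i =>
    Submodule.subset_span (Set.mem_range_self i)
  exact add_mem (add_mem (Submodule.smul_mem _ _ (h 0)) (Submodule.smul_mem _ _ (h 1)))
    (Submodule.smul_mem _ _ (h 2))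

theorem orthonormal_triple {u v w : E} (hu : ‖u‖ = 1) (hv : ‖v‖ = 1) (hw : ‖w‖ = 1)
    (huv : inner 𝕜 u v = 0) (huw : inner 𝕜 u w = 0) (hvw : inner 𝕜 v w = 0) :
    Orthonormal 𝕜 ![u, v, w] := by
  refine ⟨fun i => by fin_cases i <;> assumption, fun i j hij => ?_⟩
  fin_cases i <;> fin_cases j <;>
    first
    | exact absurd rfl hij
    | assumption
    | exact inner_eq_zero_symm.1 (by assumption)

/-- Scalar-invariant functions that are bounded below and have constant sums over the orthonormal
triples of every three-dimensional subspace are phase quadratic after multiplication by the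
squared norm. -/
theorem isPhaseQuadratic_of_triple_weight {g : E → ℝ} {m : ℝ}
    (hsmul : ∀ (c : 𝕜) (x : E), c ≠ 0 → g (c • x) = g x)
    (hweight : ∀ e : Fin 3 → E, Orthonormal 𝕜 e → ∃ W : ℝ, ∀ v : Fin 3 → E, Orthonormal 𝕜 v →
      (∀ i, v i ∈ Submodule.span 𝕜 (Set.range e)) → ∑ i, g (v i) = W)
    (hm : ∀ x ≠ 0, m ≤ g x)
    (hthird : ∀ u v : E, ‖u‖ = 1 → ‖v‖ = 1 → inner 𝕜 u v = 0 →
      ∃ w : E, ‖w‖ = 1 ∧ inner 𝕜 u w = 0 ∧ inner 𝕜 v w = 0) :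
    IsPhaseQuadratic fun x : E => ((‖x‖ ^ 2 * g x : ℝ) : 𝕜) where
  smul c x := by
    by_cases hc : c = 0
    · simp [hc]
    rw [hsmul c x hc, norm_smul, RCLike.mul_conj]
    push_cast
    ring
  polar u v huv := by
    by_cases hu : u = 0
    · refine ⟨0, fun a b => ?_⟩
      by_cases hb : b = 0
      · simp [hu, hb]
      rw [hu, smul_zero, zero_add, hsmul _ _ (by simpa using hb), norm_smul, mul_pow,
        RCLike.norm_ofReal, sq_abs]
      simp [mul_assoc]
    by_cases hv : v = 0
    · refine ⟨0, fun a b => ?_⟩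
      by_cases ha : a = 0
      · simp [hv, ha]
      rw [hv, smul_zero, add_zero, hsmul _ _ (by simpa using ha), norm_smul, mul_pow,
        RCLike.norm_ofReal, sq_abs]
      simp [mul_assoc]
    have hu0 : (‖u‖ : 𝕜) ≠ 0 := by simpa using hu
    have hv0 : (‖v‖ : 𝕜) ≠ 0 := by simpa using hv
    have hu1 : ‖(‖u‖ : 𝕜)⁻¹ • u‖ = 1 := by simp [norm_smul, hu]
    have hv1 : ‖(‖v‖ : 𝕜)⁻¹ • v‖ = 1 := by simp [norm_smul, hv]
    have huv1 : inner 𝕜 ((‖u‖ : 𝕜)⁻¹ • u) ((‖v‖ : 𝕜)⁻¹ • v) = 0 := by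
      rw [inner_smul_left, inner_smul_right, huv, mul_zero, mul_zero]
    obtain ⟨w, hw1, huw, hvw⟩ := hthird _ _ hu1 hv1 huv1
    have he := orthonormal_triple hu1 hv1 hw1 huv1 huw hvw
    set e : Fin 3 → E := ![(‖u‖ : 𝕜)⁻¹ • u, (‖v‖ : 𝕜)⁻¹ • v, w] with hedef
    obtain ⟨W, hW⟩ := hweight e he
    let L : E3 → E := tripleEmbedding (𝕜 := 𝕜) e
    have hF : IsFrame3 (fun a => g (L a)) W := by
      intro a b c ha hb hc hab hac hbc
      have hn : ∀ x : E3, x ≠ 0 → (‖x‖ : 𝕜)⁻¹ ≠ 0 := fun x hx => by simpa using hx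
      have hnorm : ∀ x : E3, x ≠ 0 → ‖(‖x‖ : 𝕜)⁻¹ • L x‖ = 1 := fun x hx => by
        rw [norm_smul, norm_tripleEmbedding he]; simp [hx]
      have hin : ∀ x y : E3, inner ℝ x y = 0 →
          inner 𝕜 ((‖x‖ : 𝕜)⁻¹ • L x) ((‖y‖ : 𝕜)⁻¹ • L y) = 0 := fun x y hxy => by
        rw [inner_smul_left, inner_smul_right, inner_tripleEmbedding he, hxy]; simp
      have h := hW _ (orthonormal_triple (hnorm a ha) (hnorm b hb) (hnorm c hc) (hin a b hab)
        (hin a c hac) (hin b c hbc)) (fun i => by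
          fin_cases i <;> exact Submodule.smul_mem _ _ (tripleEmbedding_mem_span e _))
      simp only [Fin.sum_univ_three, Matrix.cons_val] at h
      rwa [hsmul _ _ (hn a ha), hsmul _ _ (hn b hb), hsmul _ _ (hn c hc)] at h
    -- These two vectors are the preimages of u and v under `L`.
    obtain ⟨k, hk⟩ := hF.exists_polar (m := m)
      (fun x hx => hm _ (tripleEmbedding_ne_zero he hx)) !₂[‖u‖, 0, 0] !₂[0, ‖v‖, 0]
    have hLN : ∀ x : E3, ‖x‖ ^ 2 * g (L x) = ‖L x‖ ^ 2 * g (L x) := fun x => by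
      rw [norm_tripleEmbedding he]
    have hL : ∀ a b : ℝ, L (a • !₂[‖u‖, 0, 0] + b • !₂[0, ‖v‖, 0]) = (a : 𝕜) • u + (b : 𝕜) • v := by
      intro a b
      simp [L, tripleEmbedding, hedef, smul_smul, hu0, hv0]
    have hLu : L !₂[‖u‖, 0, 0] = u := by simpa using hL 1 0
    have hLv : L !₂[0, ‖v‖, 0] = v := by simpa using hL 0 1
    refine ⟨k, fun a b => ?_⟩
    have h := hk a b
    rw [hLN, hLN, hLN, hL, hLu, hLv] at h
    rw [h]
    push_cast
    ring

theorem sphere_normalize_mem {x : E} (hx : x ≠ 0) :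
    (‖x‖ : 𝕜)⁻¹ • x ∈ sphere (0 : E) 1 := by
  simp [norm_smul, hx]

open Classical in
/-- The degree zero homogeneous extension of the real part of a function on the unit sphere. -/
noncomputable def sphereExtension (𝕜 : Type*) [RCLike 𝕜] [InnerProductSpace 𝕜 E]
    (f : sphere (0 : E) 1 → EReal) (x : E) : ℝ :=
  if hx : x = 0 then 0 else (f ⟨_, sphere_normalize_mem (𝕜 := 𝕜) hx⟩).toReal

theorem sphereExtension_coe (f : sphere (0 : E) 1 → EReal) (x : sphere (0 : E) 1) :
    sphereExtension 𝕜 f x = (f x).toReal := by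
  have h1 : ‖(x : E)‖ = 1 := mem_sphere_zero_iff_norm.1 x.2
  have hx : (x : E) ≠ 0 := by rw [← norm_ne_zero_iff, h1]; exact one_ne_zero
  rw [sphereExtension, dif_neg hx]
  congr 2
  ext
  simp [h1]

theorem sphereExtension_normalize (f : sphere (0 : E) 1 → EReal) {x : E} (hx : x ≠ 0) :
    sphereExtension 𝕜 f x = sphereExtension 𝕜 f ((‖x‖ : 𝕜)⁻¹ • x) := by
  rw [sphereExtension, dif_neg hx]
  exact (sphereExtension_coe f ⟨_, sphere_normalize_mem hx⟩).symm

variable {f : sphere (0 : E) 1 → EReal}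

theorem EReal.coe_finset_sum {ι : Type*} (s : Finset ι) (a : ι → ℝ) :
    ((∑ i ∈ s, a i : ℝ) : EReal) = ∑ i ∈ s, (a i : EReal) := by
  classical
  induction s using Finset.induction_on with
  | empty => simp
  | insert i s hi ih => rw [Finset.sum_insert hi, Finset.sum_insert hi, EReal.coe_add, ih]

/-- A finite frame type function has constant sums over the orthonormal bases of a
finite-dimensional subspace. -/
theorem IsFrameTypeFunction.exists_sum_eq (hf : IsFrameTypeFunction 𝕜 f) (hfin : IsFiniteOnSphere f)
    {n : ℕ} {e : Fin n → E} (he : Orthonormal 𝕜 e) : ∃ W : ℝ, ∀ v : Fin n → E, Orthonormal 𝕜 v →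
      (∀ i, v i ∈ Submodule.span 𝕜 (Set.range e)) → ∑ i, sphereExtension 𝕜 f (v i) = W := by
  set K := Submodule.span 𝕜 (Set.range e) with hK
  have hKfin : FiniteDimensional 𝕜 K := FiniteDimensional.span_of_finite 𝕜 (Set.finite_range e)
  have hrank : Module.finrank 𝕜 K = n := by
    rw [hK, finrank_span_eq_card he.linearIndependent, Fintype.card_fin]
  obtain ⟨W, hW⟩ := hf.frame K hKfin ⊤ isClosed_univ
  refine ⟨W.toReal, fun v hv hvK => ?_⟩
  let s : Fin n → sphere (0 : K) 1 := fun i =>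
    ⟨⟨v i, hvK i⟩, mem_sphere_zero_iff_norm.2 (hv.1 i)⟩
  have hs : Orthonormal 𝕜 fun i => (s i : K) := ⟨fun i => hv.1 i, fun i j hij => hv.2 hij⟩
  have hinj : Function.Injective s := fun i j hij =>
    hs.linearIndependent.injective (congrArg Subtype.val hij)
  let φ := Equiv.ofInjective s hinj
  have hspan : Submodule.span 𝕜 (Set.range fun i => (s i : K)) = ⊤ :=
    hs.linearIndependent.span_eq_top_of_card_eq_finrank' (by rw [hrank, Fintype.card_fin])
  let b := OrthonormalBasis.mk hs hspan.ge
  have hb : ∀ i, b i = (s i : K) := fun i => by simp [b]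
  have hONB : IsONBOf (⊤ : Submodule 𝕜 K) (Set.range s) := by
    refine ⟨?_, fun _ _ => trivial, fun x _ => ?_⟩
    · have heq : (fun x : Set.range s => ((x : sphere (0 : K) 1) : K)) =
          (fun i => (s i : K)) ∘ φ.symm := by
        funext x
        simp [φ, Equiv.apply_ofInjective_symm hinj x]
      unfold IsONS
      rw [heq]
      exact hs.comp φ.symm φ.symm.injective
    · rw [← φ.hasSum_iff]
      have h := hasSum_fintype fun i => inner 𝕜 (b i) x • b i
      rw [b.sum_repr'] at h
      simp only [hb] at h
      exact h
  have hsum := (hW _ hONB).2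
  rw [← φ.hasSum_iff] at hsum
  have heq := hsum.unique (hasSum_fintype _)
  have hfv : ∀ i, ((sphereExtension 𝕜 f (v i) : ℝ) : EReal) = restrictSphere f K (s i) := by
    intro i
    have h := sphereExtension_coe (𝕜 := 𝕜) f ⟨v i, mem_sphere_zero_iff_norm.2 (hv.1 i)⟩
    rw [h, EReal.coe_toReal (hfin _).2.ne (hfin _).1.ne']
    rfl
  have hW' : W = ((∑ i, sphereExtension 𝕜 f (v i) : ℝ) : EReal) := by
    rw [heq, EReal.coe_finset_sum]
    exact Finset.sum_congr rfl fun i _ => (hfv i).symm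
  rw [hW', EReal.toReal_coe]

/-- Unit vectors on one line are orthonormal bases of the same one-dimensional subspace, so they
share its weight. -/
theorem IsFrameTypeFunction.sphereExtension_smul (hf : IsFrameTypeFunction 𝕜 f)
    (hfin : IsFiniteOnSphere f) (c : 𝕜) (x : E) (hc : c ≠ 0) :
    sphereExtension 𝕜 f (c • x) = sphereExtension 𝕜 f x := by
  by_cases hx : x = 0
  · simp [hx]
  have hone : ∀ y : E, y ≠ 0 → Orthonormal 𝕜 fun _ : Fin 1 => (‖y‖ : 𝕜)⁻¹ • y := fun y hy =>
    ⟨fun _ => mem_sphere_zero_iff_norm.1 (sphere_normalize_mem hy),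
      fun i j hij => absurd (Subsingleton.elim i j) hij⟩
  obtain ⟨W, hW⟩ := hf.exists_sum_eq hfin (hone x hx)
  have h1 := hW _ (hone x hx) fun i => Submodule.subset_span (Set.mem_range_self i)
  have h2 := hW _ (hone (c • x) (smul_ne_zero hc hx)) fun i => by
    have hx' : c • x = (c * (‖x‖ : 𝕜)) • (‖x‖ : 𝕜)⁻¹ • x := by
      rw [smul_smul, mul_inv_cancel_right₀ (by simpa using hx)]
    have hmem : c • x ∈ Submodule.span 𝕜 (Set.range fun _ : Fin 1 => (‖x‖ : 𝕜)⁻¹ • x) := by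
      rw [hx']
      exact Submodule.smul_mem _ _ (Submodule.subset_span (Set.mem_range_self i))
    exact Submodule.smul_mem _ _ hmem
  simp only [Finset.univ_unique, Finset.sum_singleton] at h1 h2
  rw [sphereExtension_normalize f hx, sphereExtension_normalize f (smul_ne_zero hc hx), h1, h2]

theorem exists_le_sphereExtension (hfin : IsFiniteOnSphere f) (hsb : IsSemiboundedOnSphere f) :
    ∃ m : ℝ, ∀ x ≠ 0, m ≤ sphereExtension 𝕜 f x := by
  obtain ⟨m, -, hm⟩ := EReal.lt_iff_exists_real_btwn.1 hsb
  refine ⟨m, fun x hx => ?_⟩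
  rw [sphereExtension, dif_neg hx, ← EReal.coe_le_coe_iff,
    EReal.coe_toReal (hfin _).2.ne (hfin _).1.ne']
  exact hm.le.trans (iInf_le _ _)

end FrameToForm

/-! ### Uniqueness and construction of the form. -/

/-- At x + d(x, y) y the diagonal equals 2|d(x, y)|². -/
theorem LinearMap.eq_zero_of_isSymmetricForm {𝕜 E : Type*} [RCLike 𝕜] [NormedAddCommGroup E]
    [InnerProductSpace 𝕜 E] {d : E →ₗ[𝕜] E →ₗ⋆[𝕜] 𝕜} (hd : IsSymmetricForm d)
    (h0 : ∀ x, d x x = 0) : d = 0 := by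
  ext x y
  have h := h0 (x + d x y • y)
  simp only [map_add, LinearMap.add_apply, LinearMap.smul_apply, LinearMap.map_smulₛₗ, h0,
    smul_eq_mul, RingHom.id_apply] at h
  rw [hd y x] at h
  have h1 : d x y * conj (d x y) = 0 := by linear_combination h / 2
  simpa using h1

theorem IsSymmetricForm.ext_of_sphere {𝕜 E : Type*} [RCLike 𝕜] [NormedAddCommGroup E]
    [InnerProductSpace 𝕜 E] {s t : E →ₗ[𝕜] E →ₗ⋆[𝕜] 𝕜} (hs : IsSymmetricForm s)
    (ht : IsSymmetricForm t) (h : ∀ x : sphere (0 : E) 1, s x x = t x x) : s = t := by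
  rw [← sub_eq_zero]
  refine LinearMap.eq_zero_of_isSymmetricForm (fun x y => ?_) fun x => ?_
  · simp only [LinearMap.sub_apply, map_sub, ← hs x y, ← ht x y]
  · by_cases hx : x = 0
    · simp [hx]
    have hx' : x = (‖x‖ : 𝕜) • (‖x‖ : 𝕜)⁻¹ • x := by
      rw [smul_smul, mul_inv_cancel₀ (by simpa using hx), one_smul]
    have h1 : s ((‖x‖ : 𝕜)⁻¹ • x) ((‖x‖ : 𝕜)⁻¹ • x) = t ((‖x‖ : 𝕜)⁻¹ • x) ((‖x‖ : 𝕜)⁻¹ • x) :=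
      h ⟨_, sphere_normalize_mem (𝕜 := 𝕜) hx⟩
    rw [hx']
    generalize (‖x‖ : 𝕜)⁻¹ • x = y at h1
    simp only [LinearMap.sub_apply, LinearMap.smul_apply, LinearMap.map_smulₛₗ, h1, sub_self,
      smul_zero]

/-- The Hermitian form obtained by polarization of a phase quadratic function. -/
noncomputable def IsPhaseQuadratic.toForm {𝕜 E : Type*} [RCLike 𝕜] [NormedAddCommGroup E]
    [InnerProductSpace 𝕜 E] {N : E → ℝ} (hN : IsPhaseQuadratic fun x => (N x : 𝕜)) :
    E →ₗ[𝕜] E →ₗ⋆[𝕜] 𝕜 :=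
  LinearMap.mk₂'ₛₗ (RingHom.id 𝕜) (starRingEnd 𝕜) (polarization 𝕜 N)
    hN.polarization_add hN.polarization_smul
    (fun x y z => by
      rw [hN.polarization_symm, hN.polarization_add, map_add, ← hN.polarization_symm,
        ← hN.polarization_symm])
    (fun c x y => by
      rw [hN.polarization_symm, hN.polarization_smul, map_mul, ← hN.polarization_symm, smul_eq_mul])

/-- Without such a w the pair would span S; then S, finite-dimensional and so closed, would by
density be H, of dimension two. In dimensions zero and one there is no orthonormal pair. -/
theorem exists_orthogonal_unit_of_dense {𝕜 H : Type*} [RCLike 𝕜] [NormedAddCommGroup H]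
    [InnerProductSpace 𝕜 H] (hdim : Module.rank 𝕜 H ≠ 2) {S : Submodule 𝕜 H}
    (hS : Dense (S : Set H)) {u v : S} (hu : ‖u‖ = 1) (hv : ‖v‖ = 1) (huv : inner 𝕜 u v = 0) :
    ∃ w : S, ‖w‖ = 1 ∧ inner 𝕜 u w = 0 ∧ inner 𝕜 v w = 0 := by
  have hON : Orthonormal 𝕜 ![u, v] := by
    refine ⟨fun i => by fin_cases i <;> assumption, fun i j hij => ?_⟩
    fin_cases i <;> fin_cases j <;>
      first
      | exact absurd rfl hij
      | assumption
      | exact inner_eq_zero_symm.1 (by assumption)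
  set K := Submodule.span 𝕜 (Set.range ![u, v]) with hK
  have hKfin : FiniteDimensional 𝕜 K := FiniteDimensional.span_of_finite 𝕜 (Set.finite_range _)
  have hrank : Module.finrank 𝕜 K = 2 := by
    rw [hK, finrank_span_eq_card hON.linearIndependent, Fintype.card_fin]
  by_cases hbot : Kᗮ = ⊥
  · exfalso
    have hKtop : K = ⊤ := Submodule.orthogonal_eq_bot_iff.1 hbot
    have hSrank : Module.finrank 𝕜 S = 2 := by rw [← hrank, hKtop, finrank_top]
    have hSfin : FiniteDimensional 𝕜 S := Module.finite_of_finrank_pos (by omega)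
    have hStop : S = ⊤ := by
      rw [← S.closed_of_finiteDimensional.submodule_topologicalClosure_eq]
      exact Submodule.dense_iff_topologicalClosure_eq_top.1 hS
    subst hStop
    apply hdim
    rw [← rank_top 𝕜 H, ← Module.finrank_eq_rank, hSrank]
    norm_num
  · obtain ⟨w, hwK, hw⟩ := (Submodule.ne_bot_iff _).1 hbot
    have hmem : ∀ i, inner 𝕜 (![u, v] i) w = 0 := fun i =>
      (Submodule.mem_orthogonal K w).1 hwK _ (Submodule.subset_span (Set.mem_range_self i))
    refine ⟨(‖w‖ : 𝕜)⁻¹ • w, by simp [norm_smul, hw], ?_, ?_⟩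
    · rw [inner_smul_right, show inner 𝕜 u w = 0 from hmem 0, mul_zero]
    · rw [inner_smul_right, show inner 𝕜 v w = 0 from hmem 1, mul_zero]

theorem theorem2p2 {𝕜 H : Type*} [RCLike 𝕜] [NormedAddCommGroup H] [InnerProductSpace 𝕜 H]
    [CompleteSpace H] (hdim : Module.rank 𝕜 H ≠ 2)
    (S : Submodule 𝕜 H) (hS : Dense (S : Set H))
    (f : sphere (0 : S) 1 → EReal) (hf : IsFrameTypeFunction 𝕜 f)
    (hfin : IsFiniteOnSphere f) (hsb : IsSemiboundedOnSphere f) :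
    ∃! t : S →ₗ[𝕜] S →ₗ⋆[𝕜] 𝕜,
      IsSymmetricForm t ∧ IsSemiboundedForm t ∧
        ∀ x : sphere (0 : S) 1, t x x = ((f x).toReal : 𝕜) := by
  obtain ⟨m, hm⟩ := exists_le_sphereExtension (𝕜 := 𝕜) hfin hsb
  have hN := isPhaseQuadratic_of_triple_weight (hf.sphereExtension_smul hfin)
    (fun _ he => hf.exists_sum_eq hfin he) hm
    (fun _ _ hu hv huv => exists_orthogonal_unit_of_dense hdim hS hu hv huv)
  have hdiag : ∀ x : sphere (0 : S) 1, hN.toForm x x = ((f x).toReal : 𝕜) := fun x => by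
    have h1 : ‖(x : S)‖ = 1 := mem_sphere_zero_iff_norm.1 x.2
    refine (hN.polarization_self (x : S)).trans ?_
    rw [sphereExtension_coe, h1, one_pow, one_mul]
  refine ⟨hN.toForm, ⟨hN.polarization_symm, ?_, hdiag⟩, ?_⟩
  · have h : ∀ x : sphere (0 : S) 1, ((RCLike.re (hN.toForm x x) : ℝ) : EReal) = f x := fun x => by
      rw [hdiag, RCLike.ofReal_re, EReal.coe_toReal (hfin x).2.ne (hfin x).1.ne']
    unfold IsSemiboundedForm
    simp only [h]
    exact hsb
  · rintro t ⟨ht, -, htf⟩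
    exact ht.ext_of_sphere hN.polarization_symm fun x => by rw [htf, hdiag]
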